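/- **Conventions.** A geodesic metric space is CAT(0) if its geodesic triangles are at least as thin as Euclidean triangles with the same side lengths. Let $X$ and $Y$ be proper CAT(0) spaces with base-points $\mathfrak o_X$, $\mathfrak o_Y$; write $\|x\|=d(\mathfrak o,x)$. A map $\Phi:X\to Y$ is a $(k,K)$-quasi-isometry ($k\ge 1$, $K\ge 0$) if $\frac1k d(x_1,x_2)-K\le d(\Phi x_1,\Phi x_2)\le k\,d(x_1,x_2)+K$ for all $x_1,x_2$ and every point of $Y$ is within $K$ of the image; it need not be continuous or preserve base-points. A sublinear function is a monotone increasing (not necessarily strictly), concave $\kappa:[0,\infty)\to[1,\infty)$ with $\kappa(t)/t\to 0$ as $t\to\infty$; write $\kappa(x)=\kappa(\|x\|)$. A $(q,Q)$-quasi-geodesic ($q\ge1$, $Q\ge0$) is a continuous map $\beta$ from an interval with $\frac1q|s-t|-Q\le d(\beta(s),\beta(t))\le q|s-t|+Q$; a quasi-geodesic ray is one defined on $[0,\infty)$, for some $(q,Q)$, with $\beta(0)=\mathfrak o$, and a geodesic ray is an isometric one. Put $\mathcal N_\kappa(Z,n)=\{x: d(x,Z)\le n\,\kappa(x)\}$.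 Two quasi-geodesic rays $\kappa$-fellow travel if each lies in $\mathcal N_\kappa$ of the other for some $n$; this is an equivalence relation, with classes $[\beta]$. A closed set $Z$ is $\kappa$-contracting if there is $c$ with: $d(x,y)\le d(x,Z)$ implies $\operatorname{diam}(x_Z\cup y_Z)\le c\,\kappa(x)$, where $x_Z$ is the set of points of $Z$ nearest to $x$. The $\kappa$-Morse boundary $\partial_\kappa X$ is the set of classes containing a quasi-geodesic ray with $\kappa$-contracting image. For $r>0$ let $t_r$ be the first time with $\|\beta(t_r)\|=r$, and $\beta|_r=\beta[0,t_r]$. Call $D$ small compared to $r$ if $D\le r/(2\kappa(r))$. A strong Morse gauge for $Z$ is a function $m(q,Q)\ge\max(q,Q)$ on $\{q\ge 1,\ Q\ge 0\}$ such that (i) every $(q,Q)$-quasi-geodesic segment with endpoints on $Z$ lies in $\mathcal N_\kappa(Z,m(q,Q))$; and (ii) for all $r,n>0$ and every sublinear $\kappa'$ there is $R>0$ such that, for every $(q,Q)$-quasi-geodesic ray $\eta$ with $m(q,Q)$ small compared to $r$, $d(\eta(t_R),Z)\le n\,\kappa'(R)$ implies $\eta|_r\subset\mathcal N_\kappa(Z,m(q,Q))$.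 For each $\mathbf b\in\partial_\kappa X$ choose a geodesic ray $b\in\mathbf b$ and a strong Morse gauge $m_b$ for $b$. Let $\mathcal U_\kappa(\mathbf b,r)$ be the set of $\mathbf a\in\partial_\kappa X$ such that $\alpha|_r\subset\mathcal N_\kappa(b,m_b(q,Q))$ for every $(q,Q)$-quasi-geodesic ray $\alpha\in\mathbf a$ with $m_b(q,Q)$ small compared to $r$. In the *visual topology on quasi-geodesics*, $\mathcal W\subset\partial_\kappa X$ is open if for every $\mathbf b\in\mathcal W$ there is $r>0$ with $\mathcal U_\kappa(\mathbf b,r)\subset\mathcal W$. For a quasi-geodesic ray $\beta$ in $X$, write $\Phi\circ\beta$ also for any quasi-geodesic ray in $Y$ (continuous and starting at $\mathfrak o_Y$) at bounded distance $\sup_t d(\gamma(t),\Phi(\beta(t)))<\infty$ from the actual composition. **Theorem.** Let $\Phi:X\to Y$ be a $(k,K)$-quasi-isometry between proper CAT(0) spaces. Then for every sublinear function $\kappa$: every class in $\partial_\kappa X$ and in $\partial_\kappa Y$ contains a geodesic ray that has a strong Morse gauge, so that the topologies above can be formed; every quasi-geodesic ray $\beta$ in $X$ admits an adjusted ray $\Phi\circ\beta$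 in $Y$; and $$\Phi^\star:\partial_\kappa X\to\partial_\kappa Y,\qquad \Phi^\star(\mathbf b)=[\Phi\circ\beta]\quad(\beta\in\mathbf b)$$ is well defined, independent of the choice of $\beta\in\mathbf b$ and of the adjusted ray, and is a homeomorphism for the visual topologies on quasi-geodesics, whatever geodesic rays and strong Morse gauges are chosen to form them. -/

import Mathlib

open Set Filter Topology
open scoped NNReal

namespace SublinearMorse

/-- A CAT(0) space: a geodesic metric space in which geodesic triangles are at least as thin as
Euclidean triangles with the same side lengths. In a geodesic space a point `x` lies on a geodesic
edge `[p, q]` exactly when `dist p x + dist x q = dist p q`. -/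
structure IsCAT0 (X : Type*) [MetricSpace X] : Prop where
  geodesic : ∀ x y : X, ∃ c : ℝ → X, c 0 = x ∧ c (dist x y) = y ∧
    ∀ s ∈ Icc 0 (dist x y), ∀ t ∈ Icc 0 (dist x y), dist (c s) (c t) = |s - t|
  thin : ∀ p q r x y : X,
    dist p x + dist x q = dist p q → dist p y + dist y r = dist p r →
    ∀ p' q' r' x' y' : EuclideanSpace ℝ (Fin 2),
      dist p' q' = dist p q → dist q' r' = dist q r → dist p' r' = dist p r →
      dist p' x' = dist p x → dist x' q' = dist x q →
      dist p' y' = dist p y → dist y' r' = dist y r →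
      dist x y ≤ dist x' y'

/-- `Φ` is a `(k, K)`-quasi-isometry. -/
structure IsQuasiIsometry {X Y : Type*} [MetricSpace X] [MetricSpace Y]
    (k K : ℝ) (Φ : X → Y) : Prop where
  one_le : 1 ≤ k
  nonneg : 0 ≤ K
  lower : ∀ x₁ x₂ : X, 1 / k * dist x₁ x₂ - K ≤ dist (Φ x₁) (Φ x₂)
  upper : ∀ x₁ x₂ : X, dist (Φ x₁) (Φ x₂) ≤ k * dist x₁ x₂ + K
  coarsely_onto : ∀ y : Y, ∃ x : X, dist y (Φ x) ≤ K

/-- A monotone, concave, sublinear function `κ : [0, ∞) → [1, ∞)`. Only the values on `[0, ∞)`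
matter. -/
structure SublinearFunction where
  toFun : ℝ → ℝ
  one_le' : ∀ t, 0 ≤ t → 1 ≤ toFun t
  mono' : MonotoneOn toFun (Ici 0)
  concave' : ConcaveOn ℝ (Ici 0) toFun
  sublinear' : Tendsto (fun t => toFun t / t) atTop (𝓝 0)

instance : CoeFun SublinearFunction (fun _ => ℝ → ℝ) := ⟨SublinearFunction.toFun⟩

section Space

variable {X : Type*} [MetricSpace X]

/-- `β : [0, ∞) → X` is a `(q, Q)`-quasi-isometric embedding. -/
structure IsQIRay (q Q : ℝ) (β : ℝ≥0 → X) : Prop where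
  one_le : 1 ≤ q
  nonneg : 0 ≤ Q
  lower : ∀ s t : ℝ≥0, 1 / q * dist s t - Q ≤ dist (β s) (β t)
  upper : ∀ s t : ℝ≥0, dist (β s) (β t) ≤ q * dist s t + Q

/-- `β : [s, t] → X` is a `(q, Q)`-quasi-geodesic segment. -/
structure IsQuasiGeodesicSegment (q Q s t : ℝ) (β : ℝ → X) : Prop where
  le : s ≤ t
  one_le : 1 ≤ q
  nonneg : 0 ≤ Q
  continuousOn : ContinuousOn β (Icc s t)
  lower : ∀ u ∈ Icc s t, ∀ v ∈ Icc s t, 1 / q * |u - v| - Q ≤ dist (β u) (β v)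
  upper : ∀ u ∈ Icc s t, ∀ v ∈ Icc s t, dist (β u) (β v) ≤ q * |u - v| + Q

/-- A quasi-geodesic ray: a continuous quasi-isometric embedding `[0, ∞) → X` starting from
the base-point `o`. -/
structure QuasiGeodesicRay (o : X) where
  toFun : ℝ≥0 → X
  continuous' : Continuous toFun
  start' : toFun 0 = o
  quasi' : ∃ q Q : ℝ, IsQIRay q Q toFun

instance (o : X) : CoeFun (QuasiGeodesicRay o) (fun _ => ℝ≥0 → X) :=
  ⟨QuasiGeodesicRay.toFun⟩

/-- The `(κ, n)`-neighbourhood of `Z`; the norm of `x` is its distance to the base-point `o`. -/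
def nbhd (κ : SublinearFunction) (o : X) (Z : Set X) (n : ℝ) : Set X :=
  {x | Metric.infDist x Z ≤ n * κ (dist o x)}

/-- Two quasi-geodesic rays `κ`-fellow travel. -/
def FellowTravel (κ : SublinearFunction) {o : X} (β γ : QuasiGeodesicRay o) : Prop :=
  (∃ n, range β ⊆ nbhd κ o (range γ) n) ∧ (∃ n, range γ ⊆ nbhd κ o (range β) n)

theorem SublinearFunction.map_mul_le (κ : SublinearFunction) {a t : ℝ} (ha : 1 ≤ a)
    (ht : 0 ≤ t) : κ (a * t) ≤ a * κ t := by
  have ha0 : 0 < a := by linarith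
  have h := κ.concave'.2 (mem_Ici.2 (by positivity : 0 ≤ a * t)) (mem_Ici.2 (le_refl (0 : ℝ)))
    (by positivity : 0 ≤ 1 / a)
    (by rw [sub_nonneg, div_le_one ha0]; exact ha : 0 ≤ 1 - 1 / a) (by ring)
  have h0 := κ.one_le' 0 le_rfl
  have hb : 0 ≤ 1 - 1 / a := by rw [sub_nonneg, div_le_one ha0]; exact ha
  have e : (1 / a) • (a * t) + (1 - 1 / a) • (0 : ℝ) = t := by
    simp only [smul_eq_mul]; field_simp; ring
  rw [e] at h
  simp only [smul_eq_mul] at h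
  have h2 : 1 / a * κ (a * t) ≤ κ t := by nlinarith
  calc κ (a * t) = a * (1 / a * κ (a * t)) := by field_simp
    _ ≤ a * κ t := by gcongr

theorem SublinearFunction.map_add_mul_le (κ : SublinearFunction) {n t : ℝ} (hn : 1 ≤ n)
    (ht : 0 ≤ t) : κ (t + n * κ t) ≤ (2 + 2 * n * κ 1) * κ t := by
  have h1 := κ.one_le' t ht
  have h11 := κ.one_le' 1 zero_le_one
  have hn1 : 1 ≤ n * κ t := by nlinarith
  have hp : 0 ≤ 2 * n * κ 1 * κ t := by positivity
  rcases le_total (n * κ t) t with h | h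
  · calc κ (t + n * κ t) ≤ κ (2 * t) := κ.mono' (mem_Ici.2 (by positivity))
          (mem_Ici.2 (by positivity)) (by linarith)
      _ ≤ 2 * κ t := κ.map_mul_le one_le_two ht
      _ ≤ (2 + 2 * n * κ 1) * κ t := by linarith
  · calc κ (t + n * κ t) ≤ κ (2 * (n * κ t) * 1) := κ.mono' (mem_Ici.2 (by positivity))
            (mem_Ici.2 (by positivity)) (by linarith)
      _ ≤ 2 * (n * κ t) * κ 1 := κ.map_mul_le (by linarith) zero_le_one
      _ ≤ (2 + 2 * n * κ 1) * κ t := by linarith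

theorem subset_nbhd_trans (κ : SublinearFunction) (o : X) {A B C : Set X} (hB : B.Nonempty)
    {n m : ℝ} (hAB : A ⊆ nbhd κ o B n) (hBC : B ⊆ nbhd κ o C m) :
    ∃ l, A ⊆ nbhd κ o C l := by
  set N := |n| + 1
  have hN1 : 1 ≤ N := by have := abs_nonneg n; linarith
  have h11 := κ.one_le' 1 zero_le_one
  refine ⟨|m| * (2 + 2 * N * κ 1) + N, fun x hx => ?_⟩
  have hκx := κ.one_le' (dist o x) dist_nonneg
  have h1 : Metric.infDist x B < N * κ (dist o x) := by
    have h : Metric.infDist x B ≤ n * κ (dist o x) := hAB hx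
    have := le_abs_self n
    have : n * κ (dist o x) ≤ |n| * κ (dist o x) := by gcongr
    have : N * κ (dist o x) = |n| * κ (dist o x) + κ (dist o x) := by ring
    linarith
  obtain ⟨y, hy, hxy⟩ := (Metric.infDist_lt_iff hB).1 h1
  have h2 : Metric.infDist y C ≤ m * κ (dist o y) := hBC hy
  have h3 : κ (dist o y) ≤ (2 + 2 * N * κ 1) * κ (dist o x) := by
    refine le_trans (κ.mono' (mem_Ici.2 dist_nonneg) (mem_Ici.2 ?_) ?_)
      (κ.map_add_mul_le hN1 dist_nonneg)
    · positivity
    · have := dist_triangle o x y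
      linarith
  have hκy := κ.one_le' (dist o y) dist_nonneg
  have h4 : m * κ (dist o y) ≤ |m| * ((2 + 2 * N * κ 1) * κ (dist o x)) :=
    (mul_le_mul_of_nonneg_right (le_abs_self m) (by linarith)).trans
      (mul_le_mul_of_nonneg_left h3 (abs_nonneg m))
  have h5 := Metric.infDist_le_infDist_add_dist (s := C) (x := x) (y := y)
  change Metric.infDist x C ≤ _
  have e : (|m| * (2 + 2 * N * κ 1) + N) * κ (dist o x) =
    |m| * ((2 + 2 * N * κ 1) * κ (dist o x)) + N * κ (dist o x) := by ring
  rw [e]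
  linarith

/-- Fellow travelling is an equivalence relation on quasi-geodesic rays. -/
def fellowTravelSetoid (κ : SublinearFunction) (o : X) : Setoid (QuasiGeodesicRay o) where
  r := FellowTravel κ
  iseqv :=
    { refl := fun β => by
        have h : range β ⊆ nbhd κ o (range β) 0 := fun x hx => by
          change Metric.infDist x (range β) ≤ 0 * κ (dist o x)
          rw [Metric.infDist_zero_of_mem hx, zero_mul]
        exact ⟨⟨0, h⟩, ⟨0, h⟩⟩
      symm := fun h => ⟨h.2, h.1⟩
      trans := fun {α β γ} h h' => by
        obtain ⟨⟨n, hn⟩, ⟨n', hn'⟩⟩ := h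
        obtain ⟨⟨m, hm⟩, ⟨m', hm'⟩⟩ := h'
        exact ⟨subset_nbhd_trans κ o (range_nonempty _) hn hm,
          subset_nbhd_trans κ o (range_nonempty _) hm' hn'⟩ }

/-- The set `x_Z` of nearest points of `Z` to `x`. -/
def nearest (Z : Set X) (x : X) : Set X := {z ∈ Z | dist x z = Metric.infDist x Z}

/-- The closed set `Z` is `κ`-contracting. -/
def IsContracting (κ : SublinearFunction) (o : X) (Z : Set X) : Prop :=
  ∃ c : ℝ, ∀ x y : X, dist x y ≤ Metric.infDist x Z →
    Metric.diam (nearest Z x ∪ nearest Z y) ≤ c * κ (dist o x)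

/-- The class of a quasi-geodesic ray up to `κ`-fellow travelling. -/
def rayClass (κ : SublinearFunction) {o : X} (β : QuasiGeodesicRay o) :
    Quotient (fellowTravelSetoid κ o) :=
  Quotient.mk _ β

/-- The `κ`-Morse boundary: fellow travelling classes of `κ`-contracting quasi-geodesic rays. -/
def MorseBoundary (κ : SublinearFunction) (o : X) : Type _ :=
  {b : Quotient (fellowTravelSetoid κ o) //
    ∃ β : QuasiGeodesicRay o, IsContracting κ o (range β) ∧ rayClass κ β = b}

/-- `β` belongs to the class `b`. -/
def Belongs {κ : SublinearFunction} {o : X} (β : QuasiGeodesicRay o) (b : MorseBoundary κ o) :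
    Prop :=
  rayClass κ β = b.1

/-- `D` is small compared to the radius `r`. -/
def IsSmall (κ : SublinearFunction) (D r : ℝ) : Prop := D ≤ r / (2 * κ r)

/-- The first time at which the ray `β` has norm `r`. -/
noncomputable def firstTime {o : X} (β : QuasiGeodesicRay o) (r : ℝ) : ℝ≥0 :=
  sInf {t | dist o (β t) = r}

/-- The initial part `β|_r = β[0, t_r]` of `β`, where `t_r` is the first time of norm `r`. -/
def initialPart {o : X} (β : QuasiGeodesicRay o) (r : ℝ) : Set X :=
  β '' Iic (firstTime β r)

/-- `m` is a `κ`-Morse gauge for `Z`. -/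
structure IsMorseGauge (κ : SublinearFunction) (o : X) (Z : Set X) (m : ℝ → ℝ → ℝ) : Prop where
  max_le : ∀ q Q, 1 ≤ q → 0 ≤ Q → max q Q ≤ m q Q
  morse : ∀ q Q s t (ζ : ℝ → X), IsQuasiGeodesicSegment q Q s t ζ → ζ s ∈ Z → ζ t ∈ Z →
    ζ '' Icc s t ⊆ nbhd κ o Z (m q Q)

/-- `m` is a strong `κ`-Morse gauge for `Z`: a Morse gauge such that a quasi-geodesic ray which,
when it first reaches a suitable large radius `R`, is `κ'`-close to `Z`, stays up to radius `r` in
the `κ`-neighbourhood of `Z` given by `m`. -/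
structure IsStrongMorseGauge (κ : SublinearFunction) (o : X) (Z : Set X) (m : ℝ → ℝ → ℝ) :
    Prop extends IsMorseGauge κ o Z m where
  strong : ∀ (r n : ℝ) (κ' : SublinearFunction), 0 < r → 0 < n → ∃ R : ℝ, 0 < R ∧
    ∀ (q Q : ℝ) (η : QuasiGeodesicRay o), IsQIRay q Q η → IsSmall κ (m q Q) r →
      Metric.infDist (η (firstTime η R)) Z ≤ n * κ' R →
      initialPart η r ⊆ nbhd κ o Z (m q Q)

/-- A geodesic ray in the class `b`, together with a strong `κ`-Morse gauge for it. -/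
structure GaugedGeodesic {κ : SublinearFunction} {o : X} (b : MorseBoundary κ o) where
  ray : QuasiGeodesicRay o
  isometry : Isometry ray
  belongs : Belongs ray b
  gauge : ℝ → ℝ → ℝ
  isGauge : IsStrongMorseGauge κ o (range ray) gauge

/-- The set `U_κ(b, r)`, with respect to the geodesic ray and the gauge in `g`. -/
def basicNbhd {κ : SublinearFunction} {o : X} {b : MorseBoundary κ o} (g : GaugedGeodesic b)
    (r : ℝ) : Set (MorseBoundary κ o) :=
  {a | ∀ (q Q : ℝ) (α : QuasiGeodesicRay o), Belongs α a → IsQIRay q Q α →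
    IsSmall κ (g.gauge q Q) r → initialPart α r ⊆ nbhd κ o (range g.ray) (g.gauge q Q)}

theorem IsSmall.mono {κ : SublinearFunction} {D r R : ℝ} (hr : 0 < r) (hrR : r ≤ R)
    (h : IsSmall κ D r) : IsSmall κ D R := by
  have hR : 0 < R := hr.trans_le hrR
  have h1 := κ.one_le' r hr.le
  have h2 := κ.one_le' R hR.le
  have h3 : κ R ≤ R / r * κ r := by
    have := κ.map_mul_le (a := R / r) (t := r) ((one_le_div hr).2 hrR) hr.le
    rwa [div_mul_cancel₀ _ hr.ne'] at this
  refine h.trans ?_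
  rw [div_le_div_iff₀ (by positivity) (by positivity)]
  have h4 : r * κ R ≤ R * κ r := by
    calc r * κ R ≤ r * (R / r * κ r) := by gcongr
      _ = R * κ r := by field_simp
  linarith

theorem exists_norm_eq {o : X} (β : QuasiGeodesicRay o) {r : ℝ} (hr : 0 ≤ r) (T : ℝ≥0)
    (hT : r ≤ dist o (β T)) : ∃ t ≤ T, dist o (β t) = r := by
  have hc : Continuous fun t => dist o (β t) := continuous_const.dist β.continuous'
  have h := intermediate_value_Icc (zero_le : 0 ≤ T) hc.continuousOn
  have h0 : dist o (β 0) = 0 := by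
    have := β.start'
    simp [this]
  obtain ⟨t, ht, e⟩ := h (⟨by rw [h0]; exact hr, hT⟩ : r ∈ Icc _ _)
  exact ⟨t, ht.2, e⟩

theorem dist_firstTime {o : X} (β : QuasiGeodesicRay o) {r : ℝ} (hr : 0 ≤ r) :
    dist o (β (firstTime β r)) = r := by
  obtain ⟨q, Q, h⟩ := β.quasi'
  have hq : 0 < q := by linarith [h.one_le]
  have hQ := h.nonneg
  have hT : 0 ≤ q * (r + Q) := by positivity
  have hl := h.lower 0 (Real.toNNReal (q * (r + Q)))
  have e : dist (0 : ℝ≥0) (Real.toNNReal (q * (r + Q))) = q * (r + Q) := by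
    rw [dist_comm, NNReal.dist_eq, Real.coe_toNNReal _ hT, NNReal.coe_zero, sub_zero,
      abs_of_nonneg hT]
  rw [e, β.start'] at hl
  obtain ⟨t, -, ht⟩ := exists_norm_eq β hr (Real.toNNReal (q * (r + Q))) (by
    refine le_trans (le_of_eq ?_) hl
    field_simp
    ring)
  have hcl : IsClosed {t | dist o (β t) = r} :=
    isClosed_eq (continuous_const.dist β.continuous') continuous_const
  exact hcl.csInf_mem ⟨t, ht⟩ (OrderBot.bddBelow _)

theorem initialPart_mono {o : X} (β : QuasiGeodesicRay o) {r R : ℝ} (hr : 0 ≤ r) (hrR : r ≤ R) :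
    initialPart β r ⊆ initialPart β R := by
  obtain ⟨t, ht, e⟩ := exists_norm_eq β hr (firstTime β R)
    (by rw [dist_firstTime β (hr.trans hrR)]; exact hrR)
  have h : firstTime β r ≤ t := csInf_le (OrderBot.bddBelow _) e
  exact image_mono (Iic_subset_Iic.2 (h.trans ht))

theorem basicNbhd_anti {κ : SublinearFunction} {o : X} {b : MorseBoundary κ o}
    (g : GaugedGeodesic b) {r R : ℝ} (hr : 0 < r) (hrR : r ≤ R) :
    basicNbhd g R ⊆ basicNbhd g r := fun _ ha q Q α hα hq hs =>
  (initialPart_mono α hr.le hrR).trans (ha q Q α hα hq (hs.mono hr hrR))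

/-- The visual topology on quasi-geodesics, for a choice `g` of the geodesic ray and of a gauge in
every class. -/
@[reducible]
def visualTopology {κ : SublinearFunction} {o : X} (g : ∀ b : MorseBoundary κ o, GaugedGeodesic b) :
    TopologicalSpace (MorseBoundary κ o) where
  IsOpen W := ∀ b ∈ W, ∃ r : ℝ, 0 < r ∧ basicNbhd (g b) r ⊆ W
  isOpen_univ := fun _ _ => ⟨1, one_pos, subset_univ _⟩
  isOpen_inter := fun V W hV hW b hb => by
    obtain ⟨r, hr, h⟩ := hV b hb.1
    obtain ⟨s, hs, h'⟩ := hW b hb.2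
    exact ⟨max r s, lt_max_of_lt_left hr,
      subset_inter ((basicNbhd_anti _ hr (le_max_left _ _)).trans h)
        ((basicNbhd_anti _ hs (le_max_right _ _)).trans h')⟩
  isOpen_sUnion := fun S hS b hb => by
    obtain ⟨W, hW, hbW⟩ := hb
    obtain ⟨r, hr, h⟩ := hS W hW b hbW
    exact ⟨r, hr, h.trans (subset_sUnion_of_mem hW)⟩

end Space

/-- The quasi-geodesic ray `γ` in `Y` is an adjustment of `Φ ∘ β`: it is continuous, starts at the
base-point of `Y`, and is at bounded distance from `Φ ∘ β`. -/
def IsAdjustment {X Y : Type*} [MetricSpace X] [MetricSpace Y] {oX : X} {oY : Y} (Φ : X → Y)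
    (β : QuasiGeodesicRay oX) (γ : QuasiGeodesicRay oY) : Prop :=
  ∃ C : ℝ, ∀ t : ℝ≥0, dist (γ t) (Φ (β t)) ≤ C

end SublinearMorse

open SublinearMorse

namespace SublinearMorse

/-! Two facts about contracting sets carry the proof: they are strongly Morse, and contraction of a
ray survives a quasi-isometry to a CAT(0) space, after straightening. Let `Ψ` be a quasi-inverse of
`Φ`.

Contracting implies strongly Morse. At height `H ≥ D κ` over `Z`, a quasi-geodesic can run for a
time of order `H / q` while its projection moves by at most `c κ`, a small fraction of that time.
But a quasi-geodesic must make progress, so an excursion away from `Z` lasts at most a multiple of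
the heights of its ends plus `κ` of its largest norm (`sub_le_of_far`). A completed excursion thus
stays within a multiple of `κ` (`exists_infDist_le_or`). If one is still going on at a large radius
`R`, at height sublinear in `R`, its duration is sublinear in `R`, so it contains no point reached
before radius `r` (`exists_strongMorseGauge`).

Contraction is transferred. Geodesics of `Y` from the base-point to points of `Φ ∘ β` are pulled
back by `Ψ` to quasi-geodesics with ends near `β`; these stay near `β`, and a limit of the geodesics
is a geodesic ray `b` fellow travelling `Φ ∘ β`. To see that `b` contracts, take `x`, `y` violating
contraction, with projections `2 * l` apart. CAT(0) geometry gives a detour of length `O(l)` at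
height at least `ε l` over `b`, with low ends at least `l` apart (`exists_detour`). Its image under
`Ψ` is cut into a number of pieces independent of `l`, each moving the projection to `β` by `O(κ)`;
yet the ends of the image are about `l / k` apart and close to their projections. Hence `l = O(κ)`
(`isContracting_of_quasiIsometry`).

So `Φ` and `Ψ` induce mutually inverse maps of boundaries. For continuity, a ray in the image class
is pulled back by `Ψ`, controlled in `X` up to a large radius, and pushed forward; closeness at the
single radius `R` suffices by the strong gauge (`continuous_boundaryMap`). -/

/-! ### Sublinear functions and quasi-inverses. -/

theorem SublinearFunction.pos (κ : SublinearFunction) {t : ℝ} (ht : 0 ≤ t) : 0 < κ t :=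
  one_pos.trans_le (κ.one_le' t ht)

theorem SublinearFunction.mono (κ : SublinearFunction) {s t : ℝ} (hs : 0 ≤ s) (h : s ≤ t) :
    κ s ≤ κ t :=
  κ.mono' (mem_Ici.2 hs) (mem_Ici.2 (hs.trans h)) h

theorem SublinearFunction.map_affine_le (κ : SublinearFunction) {a C t : ℝ} (ha : 1 ≤ a)
    (hC : 0 ≤ C) (ht : 0 ≤ t) : κ (a * t + C) ≤ (a + C) * κ 1 * κ t := by
  have h1 := κ.one_le' 1 zero_le_one
  have ht1 := κ.one_le' t ht
  rcases le_total t 1 with h | h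
  · calc κ (a * t + C) ≤ κ ((a + C) * 1) := κ.mono (by positivity) (by nlinarith)
      _ ≤ (a + C) * κ 1 := κ.map_mul_le (by linarith) zero_le_one
      _ ≤ (a + C) * κ 1 * κ t := le_mul_of_one_le_right (by positivity) ht1
  · calc κ (a * t + C) ≤ κ ((a + C) * t) := κ.mono (by positivity) (by nlinarith)
      _ ≤ (a + C) * κ t := κ.map_mul_le (by linarith) ht
      _ ≤ (a + C) * κ t * κ 1 := le_mul_of_one_le_right (by positivity) h1
      _ = (a + C) * κ 1 * κ t := by ring

theorem SublinearFunction.exists_mul_le (κ : SublinearFunction) (A : ℝ) :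
    ∃ T, 1 ≤ T ∧ ∀ t, T ≤ t → A * κ t ≤ t := by
  have h := κ.sublinear'.eventually (gt_mem_nhds (by positivity : (0 : ℝ) < 1 / (|A| + 1)))
  obtain ⟨T, hT⟩ := eventually_atTop.1 h
  refine ⟨max T 1, le_max_right _ _, fun t ht => ?_⟩
  have ht1 : 1 ≤ t := (le_max_right _ _).trans ht
  have h2 := hT t ((le_max_left _ _).trans ht)
  rw [div_lt_div_iff₀ (by linarith) (by positivity)] at h2
  have := κ.pos (by linarith : 0 ≤ t)
  nlinarith [le_abs_self A]

/-- A quantity exceeding `x` by at most a multiple of its own `κ`-value has `κ`-value comparable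
to that of `x`. -/
theorem SublinearFunction.exists_absorb (κ : SublinearFunction) (A : ℝ) :
    ∃ B, 1 ≤ B ∧ ∀ s x, 0 ≤ s → 0 ≤ x → s ≤ x + A * κ s → κ s ≤ B * κ x := by
  obtain ⟨T, hT1, hT⟩ := κ.exists_mul_le (2 * A)
  have hκT := κ.one_le' T (by linarith)
  refine ⟨2 + κ T, by linarith, fun s x hs hx h => ?_⟩
  have hκx := κ.one_le' x hx
  -- Beyond `T` the term `A * κ s` is at most `s / 2`, so `s ≤ 2 * x`; below `T`, `κ s` is at most
  -- the constant `κ T`.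
  rcases le_total T s with h' | h'
  · have h1 := hT s h'
    calc κ s ≤ κ (2 * x) := κ.mono hs (by linarith)
      _ ≤ 2 * κ x := κ.map_mul_le one_le_two hx
      _ ≤ (2 + κ T) * κ x := by nlinarith
  · have := κ.mono hs h'
    nlinarith

theorem exists_isSmall (κ : SublinearFunction) (D : ℝ) :
    ∃ T, 0 < T ∧ ∀ r, T ≤ r → IsSmall κ D r := by
  obtain ⟨T, hT1, hT⟩ := κ.exists_mul_le (2 * D)
  refine ⟨T, by linarith, fun r hr => ?_⟩
  have := κ.pos (by linarith : 0 ≤ r)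
  have := hT r hr
  rw [IsSmall, le_div_iff₀ (by positivity)]
  linarith

/-- Replace `y` by an almost nearest point `a` of `A`. Since `A` contains the base-point, `a` has
norm at most `2 * ‖y‖ + 1`, so `κ` at `a` is comparable to `κ` at `y`. -/
theorem infDist_map_le (κ : SublinearFunction) {X Y : Type*} [MetricSpace X] [MetricSpace Y]
    {oY : Y} {f : Y → X} {k K n : ℝ} (hk : 1 ≤ k) (hK : 0 ≤ K)
    (hf : ∀ y y', dist (f y) (f y') ≤ k * dist y y' + K) {A : Set Y} {B : Set X} (hA : oY ∈ A)
    (hn : ∀ a ∈ A, Metric.infDist (f a) B ≤ n * κ (dist oY a)) :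
    ∃ C, 0 ≤ C ∧ ∀ y, Metric.infDist (f y) B ≤ k * Metric.infDist y A + C * κ (dist oY y) := by
  have h1 := κ.one_le' 1 zero_le_one
  refine ⟨k + K + |n| * ((2 + 1) * κ 1), by positivity, fun y => ?_⟩
  obtain ⟨a, ha, hya⟩ := (Metric.infDist_lt_iff ⟨oY, hA⟩).1 (lt_add_one (Metric.infDist y A))
  have hy := Metric.infDist_le_dist_of_mem (x := y) hA
  rw [dist_comm] at hy
  have h2 := dist_triangle oY y a
  have h3 : κ (dist oY a) ≤ (2 + 1) * κ 1 * κ (dist oY y) :=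
    (κ.mono dist_nonneg (by linarith)).trans
      (κ.map_affine_le one_le_two zero_le_one dist_nonneg)
  have h4 := Metric.infDist_le_infDist_add_dist (s := B) (x := f y) (y := f a)
  have h5 := hf y a
  have h6 : n * κ (dist oY a) ≤ |n| * ((2 + 1) * κ 1 * κ (dist oY y)) :=
    (mul_le_mul_of_nonneg_right (le_abs_self n) (κ.pos dist_nonneg).le).trans
      (mul_le_mul_of_nonneg_left h3 (abs_nonneg n))
  have h7 := hn a ha
  have h8 := κ.one_le' _ (dist_nonneg (x := oY) (y := y))
  have h9 : k * dist y a ≤ k * (Metric.infDist y A + 1) := by gcongr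
  have h10 : k + K ≤ (k + K) * κ (dist oY y) := le_mul_of_one_le_right (by linarith) h8
  linarith [mul_assoc |n| ((2 + 1) * κ 1) (κ (dist oY y))]

theorem IsQuasiIsometry.exists_inverse {X Y : Type*} [MetricSpace X] [MetricSpace Y] {k K : ℝ}
    {Φ : X → Y} (h : IsQuasiIsometry k K Φ) :
    ∃ Ψ : Y → X, IsQuasiIsometry k (3 * k * K) Ψ ∧ (∀ y, dist (Φ (Ψ y)) y ≤ K) ∧
      ∀ x, dist (Ψ (Φ x)) x ≤ 2 * k * K := by
  have hk := h.one_le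
  have hK := h.nonneg
  have hk0 : 0 < k := by linarith
  choose Ψ hΨ using h.coarsely_onto
  have hΨ' : ∀ y, dist (Φ (Ψ y)) y ≤ K := fun y => by rw [dist_comm]; exact hΨ y
  have lower' : ∀ x x', dist x x' ≤ k * (dist (Φ x) (Φ x') + K) := fun x x' => by
    have := h.lower x x'
    rw [one_div, sub_le_iff_le_add, inv_mul_le_iff₀ hk0] at this
    exact this
  have onto : ∀ x, dist (Ψ (Φ x)) x ≤ 2 * k * K := fun x => by
    have := lower' (Ψ (Φ x)) x
    have := hΨ' (Φ x)
    nlinarith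
  refine ⟨Ψ, ⟨hk, by positivity, fun y y' => ?_, fun y y' => ?_, fun x => ⟨Φ x, ?_⟩⟩, hΨ', onto⟩
  · have h1 := h.upper (Ψ y) (Ψ y')
    have h2 : dist y y' ≤ K + dist (Φ (Ψ y)) (Φ (Ψ y')) + K := by
      have := dist_triangle4 y (Φ (Ψ y)) (Φ (Ψ y')) y'
      linarith [hΨ y, hΨ' y']
    rw [one_div, sub_le_iff_le_add, inv_mul_le_iff₀ hk0]
    have : 3 * K ≤ k * (3 * k * K) := by
      have : 1 ≤ k * k := by nlinarith
      nlinarith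
    linarith
  · have h1 := lower' (Ψ y) (Ψ y')
    have h2 : dist (Φ (Ψ y)) (Φ (Ψ y')) ≤ K + dist y y' + K := by
      have := dist_triangle4 (Φ (Ψ y)) y y' (Φ (Ψ y'))
      linarith [hΨ y', hΨ' y]
    nlinarith
  · rw [dist_comm]
    exact (onto x).trans (by nlinarith [mul_nonneg hk0.le hK])

/-! ### Quasi-geodesic rays and fellow travelling. -/

section Ray

variable {X : Type*} [MetricSpace X]

theorem IsQIRay.mono {q Q q' Q' : ℝ} {β : ℝ≥0 → X} (h : IsQIRay q Q β) (hq : q ≤ q')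
    (hQ : Q ≤ Q') : IsQIRay q' Q' β := by
  have h1 := h.one_le
  refine ⟨h1.trans hq, h.nonneg.trans hQ, fun s t => ?_, fun s t => ?_⟩
  · have := h.lower s t
    have : 1 / q' * dist s t ≤ 1 / q * dist s t := by gcongr
    linarith
  · have := h.upper s t
    have : q * dist s t ≤ q' * dist s t := by gcongr
    linarith

theorem IsQIRay.of_dist_le {q Q C : ℝ} {β γ : ℝ≥0 → X} (h : IsQIRay q Q β)
    (hC : ∀ t, dist (γ t) (β t) ≤ C) : IsQIRay q (Q + 2 * C) γ := by
  have hC0 : 0 ≤ C := dist_nonneg.trans (hC 0)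
  have hQ := h.nonneg
  refine ⟨h.one_le, by positivity, fun s t => ?_, fun s t => ?_⟩
  · have := h.lower s t
    have := dist_triangle4 (β s) (γ s) (γ t) (β t)
    linarith [hC s, hC t, dist_comm (β s) (γ s)]
  · have := h.upper s t
    have := dist_triangle4 (γ s) (β s) (β t) (γ t)
    linarith [hC s, hC t, dist_comm (β t) (γ t)]

theorem IsQIRay.dist_le {q Q : ℝ} {β : ℝ≥0 → X} (h : IsQIRay q Q β) (s t : ℝ≥0) :
    dist s t ≤ q * (dist (β s) (β t) + Q) := by
  have := h.lower s t
  rwa [one_div, sub_le_iff_le_add, inv_mul_le_iff₀ (by linarith [h.one_le])] at this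

theorem IsQIRay.norm_le {q Q : ℝ} {o : X} {β : QuasiGeodesicRay o} (h : IsQIRay q Q β)
    (t : ℝ≥0) : dist o (β t) ≤ q * t + Q := by
  have := h.upper 0 t
  rwa [β.start', dist_comm (0 : ℝ≥0), NNReal.dist_eq, NNReal.coe_zero, sub_zero,
    NNReal.abs_eq] at this

theorem IsQIRay.le_norm {q Q : ℝ} {o : X} {β : QuasiGeodesicRay o} (h : IsQIRay q Q β)
    (t : ℝ≥0) : (t : ℝ) ≤ q * (dist o (β t) + Q) := by
  have := h.dist_le 0 t
  rwa [β.start', dist_comm (0 : ℝ≥0), NNReal.dist_eq, NNReal.coe_zero, sub_zero,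
    NNReal.abs_eq] at this

theorem IsQIRay.comp {Y : Type*} [MetricSpace Y] {k K q Q : ℝ} {Φ : X → Y} {β : ℝ≥0 → X}
    (h : IsQIRay q Q β) (hΦ : IsQuasiIsometry k K Φ) :
    IsQIRay (k * q) (k * Q + K) (fun t => Φ (β t)) := by
  have hk := hΦ.one_le
  have hK := hΦ.nonneg
  have hq := h.one_le
  have hQ := h.nonneg
  refine ⟨by nlinarith, by positivity, fun s t => ?_, fun s t => ?_⟩
  · have h1 := h.lower s t
    have h2 := hΦ.lower (β s) (β t)
    have h3 : 1 / k * (1 / q * dist s t - Q) ≤ 1 / k * dist (β s) (β t) := by gcongr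
    have h4 : 1 / (k * q) * dist s t = 1 / k * (1 / q * dist s t) := by
      field_simp
    have h5 : 1 / k * Q ≤ k * Q := by
      gcongr
      rw [div_le_iff₀ (by linarith)]
      nlinarith
    rw [h4]
    linarith
  · have h1 := h.upper s t
    have h2 := hΦ.upper (β s) (β t)
    have : k * dist (β s) (β t) ≤ k * (q * dist s t + Q) := by gcongr
    linarith

theorem locallyFinite_Icc_natCast : LocallyFinite fun n : ℕ => Icc (n : ℝ≥0) (n + 1) := by
  intro x
  refine ⟨Iio (x + 1), Iio_mem_nhds (lt_add_one x), (finite_le_nat ⌈x + 1⌉₊).subset ?_⟩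
  rintro n ⟨y, hy, hy'⟩
  have : (n : ℝ≥0) ≤ ⌈x + 1⌉₊ := hy.1.trans ((le_of_lt hy').trans (Nat.le_ceil _))
  exact_mod_cast this

/-- Connecting the points `f n` by geodesics turns a quasi-isometric embedding of `[0, ∞)` into
a continuous one starting at `o`. -/
theorem exists_continuous_ray
    (geod : ∀ x y : X, ∃ c : ℝ → X, c 0 = x ∧ c (dist x y) = y ∧
      ∀ s ∈ Icc 0 (dist x y), ∀ t ∈ Icc 0 (dist x y), dist (c s) (c t) = |s - t|)
    {o : X} {q Q E : ℝ} {f : ℝ≥0 → X} (hf : IsQIRay q Q f) (hE : dist o (f 0) ≤ E) :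
    ∃ γ : QuasiGeodesicRay o, ∀ t, dist (γ t) (f t) ≤ 2 * q + 2 * Q + 2 * E := by
  have hE0 : 0 ≤ E := dist_nonneg.trans hE
  choose c hc0 hc1 hcd using geod
  set e : X → X → ℝ → X := fun x y s => c x y (s * dist x y) with he
  have he0 : ∀ x y, e x y 0 = x := fun x y => by simp [he, hc0]
  have he1 : ∀ x y, e x y 1 = y := fun x y => by simp [he, hc1]
  have hmem : ∀ x y : X, ∀ s ∈ Icc (0 : ℝ) 1, s * dist x y ∈ Icc 0 (dist x y) := fun x y s hs =>
    ⟨mul_nonneg hs.1 dist_nonneg, mul_le_of_le_one_left dist_nonneg hs.2⟩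
  have hed : ∀ x y, ∀ s ∈ Icc (0 : ℝ) 1, ∀ t ∈ Icc (0 : ℝ) 1,
      dist (e x y s) (e x y t) = |s - t| * dist x y := fun x y s hs t ht => by
    rw [he]
    dsimp only
    rw [hcd x y _ (hmem x y s hs) _ (hmem x y t ht), ← sub_mul, abs_mul,
      abs_of_nonneg (dist_nonneg (x := x) (y := y))]
  -- Only the point of index `0` is changed, so that the path starts at `o`; this costs at most `E`.
  set p : ℕ → X := fun n => if n = 0 then o else f n with hp
  have hpf : ∀ n, dist (p n) (f n) ≤ E := fun n => by
    rw [hp]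
    dsimp only
    split_ifs with h
    · rw [h, Nat.cast_zero]; exact hE
    · simpa using hE0
  have hpp : ∀ n, dist (p n) (p (n + 1)) ≤ q + Q + E := fun n => by
    have e1 : p (n + 1) = f ((n + 1 : ℕ) : ℝ≥0) := by simp [hp]
    have h1 := hf.upper n ((n + 1 : ℕ) : ℝ≥0)
    have h2 : dist (n : ℝ≥0) ((n + 1 : ℕ) : ℝ≥0) = 1 := by
      rw [NNReal.dist_eq]
      push_cast
      rw [abs_sub_comm]
      simp
    have h3 := dist_triangle (p n) (f n) (p (n + 1))
    rw [e1] at h3 ⊢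
    rw [h2] at h1
    linarith [hpf n]
  set γ : ℝ≥0 → X := fun t => e (p ⌊t⌋₊) (p (⌊t⌋₊ + 1)) (t - ⌊t⌋₊) with hγ
  have hfl : ∀ t : ℝ≥0, (t : ℝ) - ⌊t⌋₊ ∈ Icc (0 : ℝ) 1 := fun t => by
    have h1 : ((⌊t⌋₊ : ℝ≥0) : ℝ) ≤ t := NNReal.coe_le_coe.2 (Nat.floor_le (zero_le : 0 ≤ t))
    have h2 : (t : ℝ) < ((⌊t⌋₊ + 1 : ℝ≥0) : ℝ) := NNReal.coe_lt_coe.2 (Nat.lt_floor_add_one t)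
    push_cast at h1 h2
    constructor <;> linarith
  have hclose : ∀ t, dist (γ t) (f t) ≤ 2 * q + 2 * Q + 2 * E := fun t => by
    have h1 := hed (p ⌊t⌋₊) (p (⌊t⌋₊ + 1)) _ (hfl t) 0 ⟨le_rfl, zero_le_one⟩
    rw [he0, sub_zero, abs_of_nonneg (hfl t).1] at h1
    have h2 : ((t : ℝ) - ⌊t⌋₊) * dist (p ⌊t⌋₊) (p (⌊t⌋₊ + 1)) ≤ dist (p ⌊t⌋₊) (p (⌊t⌋₊ + 1)) :=
      mul_le_of_le_one_left dist_nonneg (hfl t).2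
    have h3 := hf.upper (⌊t⌋₊ : ℝ≥0) t
    have h4 : dist (⌊t⌋₊ : ℝ≥0) t ≤ 1 := by
      rw [dist_comm, NNReal.dist_eq]
      push_cast
      rw [abs_of_nonneg (hfl t).1]
      exact (hfl t).2
    have h5 : q * dist (⌊t⌋₊ : ℝ≥0) t ≤ q := mul_le_of_le_one_right (by linarith [hf.one_le]) h4
    have h6 := dist_triangle4 (γ t) (p ⌊t⌋₊) (f (⌊t⌋₊ : ℝ≥0)) (f t)
    have h7 : dist (γ t) (p ⌊t⌋₊) ≤ dist (p ⌊t⌋₊) (p (⌊t⌋₊ + 1)) := h1.le.trans h2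
    linarith [hpp ⌊t⌋₊, hpf ⌊t⌋₊]
  have hpiece : ∀ n : ℕ, EqOn γ (fun t => e (p n) (p (n + 1)) (t - n)) (Icc (n : ℝ≥0) (n + 1)) := by
    intro n t ht
    -- At the right end `t = n + 1` the floor has already jumped, but both pieces take the value `p
    -- (n + 1)` there.
    rcases ht.2.lt_or_eq with h | h
    · have : ⌊t⌋₊ = n := (Nat.floor_eq_iff (zero_le : 0 ≤ t)).2 ⟨ht.1, h⟩
      simp only [hγ, this]
    · have : ⌊t⌋₊ = n + 1 := by
        rw [h]
        exact_mod_cast Nat.floor_natCast (R := ℝ≥0) (n + 1)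
      simp only [hγ]
      rw [this, h]
      push_cast
      rw [sub_self, he0, add_sub_cancel_left, he1]
  have hcont : Continuous γ := by
    refine locallyFinite_Icc_natCast.continuous (iUnion_eq_univ_iff.2 fun t =>
      ⟨⌊t⌋₊, Nat.floor_le (zero_le : 0 ≤ t), (Nat.lt_floor_add_one t).le⟩)
      (fun _ => isClosed_Icc) fun n => ContinuousOn.congr ?_ (hpiece n)
    have hce : ContinuousOn (e (p n) (p (n + 1))) (Icc 0 1) := by
      refine (LipschitzOnWith.of_dist_le_mul (K := ⟨dist (p n) (p (n + 1)), dist_nonneg⟩)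
        fun s hs t ht => ?_).continuousOn
      rw [hed _ _ s hs t ht, Real.dist_eq, mul_comm]
      rfl
    refine hce.comp (by fun_prop) fun t ht => ?_
    have h1 : ((n : ℝ≥0) : ℝ) ≤ t := NNReal.coe_le_coe.2 ht.1
    have h2 : (t : ℝ) ≤ ((n + 1 : ℝ≥0) : ℝ) := NNReal.coe_le_coe.2 ht.2
    push_cast at h1 h2
    constructor <;> linarith
  refine ⟨⟨γ, hcont, ?_, ⟨_, _, hf.of_dist_le hclose⟩⟩, hclose⟩
  simp only [hγ, Nat.floor_zero]
  simp [he0, hp]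

theorem exists_dist_le_of_mem_nbhd {κ : SublinearFunction} {o x : X} {Z : Set X}
    (hZ : Z.Nonempty) {n : ℝ} (hx : x ∈ nbhd κ o Z n) :
    ∃ z ∈ Z, dist x z ≤ (|n| + 1) * κ (dist o x) := by
  have hκ := κ.pos (dist_nonneg (x := o) (y := x))
  have h : Metric.infDist x Z < (|n| + 1) * κ (dist o x) := by
    have h : Metric.infDist x Z ≤ n * κ (dist o x) := hx
    have := mul_le_mul_of_nonneg_right (le_abs_self n) hκ.le
    linarith [add_mul |n| 1 (κ (dist o x))]
  obtain ⟨z, hz, hxz⟩ := (Metric.infDist_lt_iff hZ).1 h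
  exact ⟨z, hz, hxz.le⟩

/-- If a quasi-geodesic ray lies in a `κ`-neighbourhood of another one, they fellow travel. -/
theorem fellowTravel_of_subset {κ : SublinearFunction} {o : X} {β γ : QuasiGeodesicRay o} {n : ℝ}
    (h : range β ⊆ nbhd κ o (range γ) n) : FellowTravel κ β γ := by
  refine ⟨⟨n, h⟩, ?_⟩
  obtain ⟨q₁, Q₁, hβ⟩ := β.quasi'
  obtain ⟨q, Q, hγ⟩ := γ.quasi'
  have hq := hγ.one_le
  have hQ := hγ.nonneg
  have hq₁ := hβ.one_le
  have hQ₁ := hβ.nonneg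
  set N := |n| + 1
  have hN : 0 ≤ N := by positivity
  -- Parameters `τ j` at which `γ` is close to `β j`. They start at `0`, are unbounded and have gaps
  -- of size `O(κ)`, so every `u` lies in such a gap and `γ u` is near some `β j`.
  have hex : ∀ j : ℕ, ∃ τ : ℝ≥0, (j = 0 → τ = 0) ∧
      dist (β j) (γ τ) ≤ N * κ (dist o (β j)) := by
    intro j
    by_cases hj : j = 0
    · refine ⟨0, fun _ => rfl, ?_⟩
      have := κ.pos (dist_nonneg (x := o) (y := β j))
      rw [hj, Nat.cast_zero, β.start', γ.start', dist_self]
      have := κ.pos (le_refl (0 : ℝ))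
      positivity
    · obtain ⟨_, ⟨τ, rfl⟩, hτ⟩ := exists_dist_le_of_mem_nbhd (range_nonempty γ)
        (h (mem_range_self (j : ℝ≥0)))
      exact ⟨τ, fun h => absurd h hj, hτ⟩
  choose τ hτ0 hτ using hex
  have hκ1 := κ.one_le' 1 zero_le_one
  set P := (1 + (q₁ + Q₁)) * κ 1 with hP
  have hP0 : 0 ≤ P := by positivity
  set A := q * (q * (N + N * P + q₁ + Q₁ + Q)) + Q + N with hA
  have hA0 : 0 ≤ A := by positivity
  obtain ⟨B, hB1, hB⟩ := κ.exists_absorb A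
  obtain ⟨B', hB1', hB'⟩ := κ.exists_absorb N
  refine ⟨A * B, ?_⟩
  rintro _ ⟨u, rfl⟩
  -- If all `τ j` were at most `u`, the points `β j` would be close to a bounded part of `γ`, hence
  -- of bounded norm.
  have hunb : ∃ j : ℕ, u < τ j := by
    by_contra! hcon
    set V := q * u + Q with hV
    have hV0 : 0 ≤ V := by positivity
    obtain ⟨j, hj⟩ := exists_nat_gt (q₁ * (V + N * (B' * κ V) + Q₁))
    have h1 : dist o (γ (τ j)) ≤ V := by
      refine (hγ.norm_le _).trans ?_
      have : ((τ j : ℝ≥0) : ℝ) ≤ u := hcon j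
      rw [hV]
      gcongr
    have h2 : dist o (β j) ≤ V + N * κ (dist o (β j)) := by
      have := dist_triangle o (γ (τ j)) (β j)
      rw [dist_comm (γ (τ j))] at this
      linarith [hτ j]
    have h3 := hB' _ V dist_nonneg hV0 h2
    have h4 : N * κ (dist o (β j)) ≤ N * (B' * κ V) := by gcongr
    have h5 := hβ.le_norm j
    have h6 : q₁ * (dist o (β j) + Q₁) ≤ q₁ * (V + N * (B' * κ V) + Q₁) := by
      gcongr
      linarith
    have h7 : ((j : ℝ≥0) : ℝ) = j := by simp
    linarith
  classical
  obtain ⟨j, hj⟩ : ∃ j, Nat.find hunb = j + 1 := by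
    refine Nat.exists_eq_succ_of_ne_zero fun h0 => ?_
    have := Nat.find_spec hunb
    rw [h0, hτ0 0 rfl] at this
    exact absurd this (not_lt.2 zero_le)
  have hup : u < τ (j + 1) := by
    have := Nat.find_spec hunb
    rwa [hj] at this
  have hlow : τ j ≤ u := not_lt.1 (Nat.find_min hunb (by omega))
  set s := dist o (β j) with hs
  have hs0 : 0 ≤ s := dist_nonneg
  have hκs := κ.one_le' s hs0
  have hstep : dist (β (j : ℝ≥0)) (β ((j + 1 : ℕ) : ℝ≥0)) ≤ q₁ + Q₁ := by
    have h1 := hβ.upper j ((j + 1 : ℕ) : ℝ≥0)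
    have h2 : dist (j : ℝ≥0) ((j + 1 : ℕ) : ℝ≥0) = 1 := by
      rw [NNReal.dist_eq]
      push_cast
      rw [abs_sub_comm]
      simp
    rw [h2] at h1
    linarith
  have hκ' : κ (dist o (β ((j + 1 : ℕ) : ℝ≥0))) ≤ P * κ s := by
    refine (κ.mono dist_nonneg ?_).trans (κ.map_affine_le le_rfl (by positivity) hs0)
    have := dist_triangle o (β j) (β ((j + 1 : ℕ) : ℝ≥0))
    linarith
  have h1 : dist (τ j) (τ (j + 1)) ≤ q * ((N + N * P + q₁ + Q₁ + Q) * κ s) := by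
    refine (hγ.dist_le _ _).trans ?_
    gcongr
    have h2 := dist_triangle4 (γ (τ j)) (β j) (β ((j + 1 : ℕ) : ℝ≥0)) (γ (τ (j + 1)))
    rw [dist_comm (γ (τ j)) (β j)] at h2
    have h3 := hτ j
    have h4 := hτ (j + 1)
    have h5 : N * κ (dist o (β ((j + 1 : ℕ) : ℝ≥0))) ≤ N * (P * κ s) := by gcongr
    have h6 : q₁ + Q₁ + Q ≤ (q₁ + Q₁ + Q) * κ s := le_mul_of_one_le_right (by positivity) hκs
    linarith
  have h2 : dist (τ j) u ≤ dist (τ j) (τ (j + 1)) := by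
    have a1 : ((τ j : ℝ≥0) : ℝ) ≤ u := hlow
    have a2 : (u : ℝ) ≤ τ (j + 1) := hup.le
    rw [dist_comm, dist_comm (τ j), NNReal.dist_eq, NNReal.dist_eq, abs_of_nonneg (by linarith),
      abs_of_nonneg (by linarith)]
    linarith
  have h3 : dist (β j) (γ u) ≤ A * κ s := by
    have a1 := dist_triangle (β j) (γ (τ j)) (γ u)
    have a2 := hγ.upper (τ j) u
    have a3 : q * dist (τ j) u ≤ q * (q * ((N + N * P + q₁ + Q₁ + Q) * κ s)) := by
      gcongr
      exact h2.trans h1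
    have a4 : Q ≤ Q * κ s := le_mul_of_one_le_right hQ hκs
    have a5 := hτ j
    rw [hA]
    linarith
  have h4 : κ s ≤ B * κ (dist o (γ u)) := by
    refine hB s _ hs0 dist_nonneg ?_
    have := dist_triangle o (γ u) (β j)
    rw [dist_comm (γ u)] at this
    linarith
  have h5 := Metric.infDist_le_dist_of_mem (x := γ u) (mem_range_self (f := β) (j : ℝ≥0))
  rw [dist_comm] at h5
  calc Metric.infDist (γ u) (range β) ≤ A * κ s := h5.trans h3
    _ ≤ A * (B * κ (dist o (γ u))) := by gcongr
    _ = A * B * κ (dist o (γ u)) := by ring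

end Ray

/-! ### CAT(0) geometry: comparison and projections to convex sets. -/

theorem exists_comparison_triangle {a b c : ℝ} (ha : 0 ≤ a) (hb : 0 ≤ b) (hc : 0 ≤ c)
    (h1 : a ≤ b + c) (h2 : b ≤ a + c) (h3 : c ≤ a + b) :
    ∃ p q r : EuclideanSpace ℝ (Fin 2), dist p q = a ∧ dist q r = b ∧ dist p r = c := by
  rcases ha.eq_or_lt with rfl | ha
  · refine ⟨0, 0, !₂[c, 0], by simp, ?_, ?_⟩ <;>
      simp [EuclideanSpace.dist_eq, Real.dist_eq, Real.sqrt_sq_eq_abs, abs_of_nonneg hc]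
    linarith
  -- The first coordinate of the apex, by the law of cosines.
  · set u := (a ^ 2 + c ^ 2 - b ^ 2) / (2 * a) with hu
    have hau : 2 * a * u = a ^ 2 + c ^ 2 - b ^ 2 := by rw [hu]; field_simp
    have huc : u ^ 2 ≤ c ^ 2 := by
      have h4 : (a ^ 2 + c ^ 2 - b ^ 2) ^ 2 ≤ (2 * a * c) ^ 2 := by
        refine sq_le_sq' ?_ ?_ <;> nlinarith
      rw [← hau] at h4
      have : (2 * a) ^ 2 * u ^ 2 ≤ (2 * a) ^ 2 * c ^ 2 := by
        linarith [mul_pow (2 * a) u 2, mul_pow (2 * a) c 2]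
      exact le_of_mul_le_mul_left this (by positivity)
    have hv : √(c ^ 2 - u ^ 2) ^ 2 = c ^ 2 - u ^ 2 := Real.sq_sqrt (by linarith)
    refine ⟨0, !₂[a, 0], !₂[u, √(c ^ 2 - u ^ 2)], ?_, ?_, ?_⟩
    · simp [EuclideanSpace.dist_eq, Real.dist_eq, Real.sqrt_sq_eq_abs, abs_of_pos ha]
    · have e : (a - u) ^ 2 + (c ^ 2 - u ^ 2) = b ^ 2 := by linarith
      rw [EuclideanSpace.dist_eq, Fin.sum_univ_two]
      simp [Real.dist_eq, sq_abs, hv, e, hb]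
    · rw [EuclideanSpace.dist_eq, Fin.sum_univ_two]
      simp [Real.dist_eq, sq_abs, hv, hc]

/-- Stewart's theorem, the Euclidean side of the comparison in `IsCAT0.dist_sq_le`. -/
theorem dist_lineMap_sq {E : Type*} [NormedAddCommGroup E] [InnerProductSpace ℝ E] (p q r : E)
    (t : ℝ) : dist (AffineMap.lineMap p q t : E) r ^ 2 =
      (1 - t) * dist p r ^ 2 + t * dist q r ^ 2 - t * (1 - t) * dist p q ^ 2 := by
  have e1 : (AffineMap.lineMap p q t : E) - r = (1 - t) • (p - r) + t • (q - r) := by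
    rw [AffineMap.lineMap_apply_module]
    module
  have e2 : p - q = (p - r) - (q - r) := by abel
  rw [dist_eq_norm, dist_eq_norm, dist_eq_norm, dist_eq_norm, e1, e2, norm_add_sq_real,
    norm_sub_sq_real (p - r) (q - r), norm_smul, norm_smul, inner_smul_left, inner_smul_right,
    mul_pow, mul_pow, Real.norm_eq_abs, Real.norm_eq_abs, sq_abs, sq_abs]
  simp only [conj_trivial]
  ring

/-- `z` divides a geodesic from `x` to `y` in the ratio `t : 1 - t`. -/
structure DividesAt {X : Type*} [MetricSpace X] (t : ℝ) (x y z : X) : Prop where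
  nonneg : 0 ≤ t
  le_one : t ≤ 1
  left : dist x z = t * dist x y
  right : dist z y = (1 - t) * dist x y

/-- `z` lies on a geodesic from `x` to `y`. -/
def OnSegment {X : Type*} [MetricSpace X] (x y z : X) : Prop := dist x z + dist z y = dist x y

/-- Geodesics between points of `Z` stay in `Z`. -/
def IsGeodesicallyConvex {X : Type*} [MetricSpace X] (Z : Set X) : Prop :=
  ∀ x ∈ Z, ∀ y ∈ Z, ∀ z, OnSegment x y z → z ∈ Z

section Metric

variable {X : Type*} [MetricSpace X] {x y z w p q r : X} {t : ℝ}

theorem DividesAt.onSegment (h : DividesAt t x y z) : OnSegment x y z := by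
  rw [OnSegment, h.left, h.right]
  ring

theorem DividesAt.symm (h : DividesAt t x y z) : DividesAt (1 - t) y x z :=
  ⟨by linarith [h.le_one], by linarith [h.nonneg],
    by rw [dist_comm, h.right, dist_comm x y],
    by rw [dist_comm, h.left, dist_comm x y]; ring⟩

theorem OnSegment.symm (h : OnSegment x y z) : OnSegment y x z := by
  rw [OnSegment] at h ⊢
  rw [dist_comm y z, dist_comm z x, dist_comm y x]
  linarith

theorem OnSegment.dividesAt (h : OnSegment x y z) : ∃ t, DividesAt t x y z := by
  rw [OnSegment] at h
  rcases (dist_nonneg (x := x) (y := y)).eq_or_lt with h0 | h0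
  · have h1 := dist_nonneg (x := x) (y := z)
    have h2 := dist_nonneg (x := z) (y := y)
    exact ⟨0, le_rfl, zero_le_one, by linarith, by linarith⟩
  · refine ⟨dist x z / dist x y, by positivity, ?_, ?_, ?_⟩
    · rw [div_le_one h0]
      linarith [dist_nonneg (x := z) (y := y)]
    · field_simp
    · field_simp
      linarith

theorem OnSegment.trans_left (h : OnSegment x y z) (h' : OnSegment x z w) : OnSegment x y w := by
  rw [OnSegment] at *
  have := dist_triangle w z y
  have := dist_triangle x w y
  linarith

variable {Z : Set X}

theorem nearest_nonempty [ProperSpace X] (hZ : IsClosed Z) (hne : Z.Nonempty) (x : X) :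
    (nearest Z x).Nonempty := by
  obtain ⟨z, hz, h⟩ := hZ.exists_infDist_eq_dist hne x
  exact ⟨z, hz, h.symm⟩

theorem nearest_of_onSegment (hp : p ∈ nearest Z x) (h : OnSegment p x z) : p ∈ nearest Z z := by
  refine ⟨hp.1, le_antisymm ?_ (Metric.infDist_le_dist_of_mem hp.1)⟩
  have h1 := Metric.infDist_le_infDist_add_dist (s := Z) (x := x) (y := z)
  have h2 := hp.2
  rw [OnSegment] at h
  rw [dist_comm z p]
  rw [dist_comm x p] at h2
  rw [dist_comm x z] at h1
  linarith

end Metric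

namespace IsCAT0

variable {X : Type*} [MetricSpace X] {x y z w p q r : X} {s t : ℝ} {Z : Set X}

theorem exists_dividesAt (hX : IsCAT0 X) (x y : X) (ht0 : 0 ≤ t) (ht1 : t ≤ 1) :
    ∃ z, DividesAt t x y z := by
  obtain ⟨c, h0, h1, hc⟩ := hX.geodesic x y
  have hd := dist_nonneg (x := x) (y := y)
  have hm : t * dist x y ∈ Icc 0 (dist x y) := ⟨by positivity, mul_le_of_le_one_left hd ht1⟩
  refine ⟨c (t * dist x y), ht0, ht1, ?_, ?_⟩
  · have := hc 0 ⟨le_rfl, hd⟩ _ hm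
    rw [h0, zero_sub, abs_neg, abs_of_nonneg hm.1] at this
    exact this
  · have := hc _ hm (dist x y) ⟨hd, le_rfl⟩
    rw [h1, abs_sub_comm, abs_of_nonneg (by linarith [hm.2])] at this
    rw [this]
    ring

theorem exists_comparison (p q r : X) : ∃ p' q' r' : EuclideanSpace ℝ (Fin 2),
    dist p' q' = dist p q ∧ dist q' r' = dist q r ∧ dist p' r' = dist p r := by
  refine exists_comparison_triangle dist_nonneg dist_nonneg dist_nonneg ?_ ?_ ?_
  · linarith [dist_triangle p r q, dist_comm r q]
  · linarith [dist_triangle q p r, dist_comm p q]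
  · exact dist_triangle p q r

/-- The Bruhat–Tits inequality: thinness with the second point at the vertex `r`. -/
theorem dist_sq_le (hX : IsCAT0 X) (h : DividesAt t p q x) (r : X) :
    dist x r ^ 2 ≤ (1 - t) * dist p r ^ 2 + t * dist q r ^ 2 - t * (1 - t) * dist p q ^ 2 := by
  obtain ⟨p', q', r', h1, h2, h3⟩ := exists_comparison p q r
  have h4 := hX.thin p q r x r h.onSegment (by simp) p' q' r' (AffineMap.lineMap p' q' t) r'
    h1 h2 h3 (by rw [dist_left_lineMap, h1, h.left, Real.norm_of_nonneg h.nonneg])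
    (by rw [dist_lineMap_right, h1, h.right, Real.norm_of_nonneg (by linarith [h.le_one])])
    h3 (by simp)
  rw [← h1, ← h2, ← h3, ← dist_lineMap_sq]
  gcongr

theorem dist_le_of_apex (hX : IsCAT0 X) (hx : DividesAt t p q x) (hy : DividesAt t p r y) :
    dist x y ≤ t * dist q r := by
  obtain ⟨p', q', r', h1, h2, h3⟩ := exists_comparison p q r
  have ht := hx.nonneg
  have ht' : 0 ≤ 1 - t := by linarith [hx.le_one]
  have h4 := hX.thin p q r x y hx.onSegment hy.onSegment p' q' r' (AffineMap.lineMap p' q' t)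
    (AffineMap.lineMap p' r' t) h1 h2 h3
    (by rw [dist_left_lineMap, h1, hx.left, Real.norm_of_nonneg ht])
    (by rw [dist_lineMap_right, h1, hx.right, Real.norm_of_nonneg ht'])
    (by rw [dist_left_lineMap, h3, hy.left, Real.norm_of_nonneg ht])
    (by rw [dist_lineMap_right, h3, hy.right, Real.norm_of_nonneg ht'])
  refine h4.trans (le_of_eq ?_)
  have e : (AffineMap.lineMap p' q' t : EuclideanSpace ℝ (Fin 2)) - AffineMap.lineMap p' r' t =
      t • (q' - r') := by
    rw [AffineMap.lineMap_apply_module, AffineMap.lineMap_apply_module]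
    module
  rw [dist_eq_norm, e, norm_smul, ← dist_eq_norm, h2, Real.norm_of_nonneg ht]

theorem dividesAt_unique (hX : IsCAT0 X) (hx : DividesAt t p q x) (hy : DividesAt t p q y) :
    x = y := by
  have := hX.dist_le_of_apex hx hy
  rw [dist_self, mul_zero] at this
  exact dist_le_zero.1 this

/-- The distance function is convex. -/
theorem dist_le_of_dividesAt (hX : IsCAT0 X) {x' y' z' : X} (h : DividesAt t x y z)
    (h' : DividesAt t x' y' z') : dist z z' ≤ (1 - t) * dist x x' + t * dist y y' := by
  obtain ⟨v, hv⟩ := hX.exists_dividesAt x y' h.nonneg h.le_one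
  have h1 := hX.dist_le_of_apex h hv
  have h2 := hX.dist_le_of_apex hv.symm h'.symm
  linarith [dist_triangle z v z']

/-- Apply `dist_sq_le` from `y` and from `p` to the midpoint `m` of `x` and `q`, and bound the
square of `dist y p` by twice the sum of the squares of `dist y m` and `dist m p`. -/
theorem dist_sq_add_dist_sq_le (hX : IsCAT0 X) (x y p q : X) :
    dist x q ^ 2 + dist y p ^ 2 ≤
      dist x p ^ 2 + dist y q ^ 2 + dist x y ^ 2 + dist p q ^ 2 := by
  obtain ⟨m, hm⟩ := hX.exists_dividesAt (t := 1 / 2) x q (by norm_num) (by norm_num)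
  have h1 := hX.dist_sq_le hm y
  have h2 := hX.dist_sq_le hm p
  have h3 := dist_triangle y m p
  rw [dist_comm m y, dist_comm q y] at h1
  rw [dist_comm q p] at h2
  have h4 : dist y p ^ 2 ≤ (dist y m + dist m p) ^ 2 := by gcongr
  nlinarith [sq_nonneg (dist y m - dist m p)]

/-- The angle at the projection is not acute: points of `[p, q]` close to `p` lie in `Z`, so they
are no closer to `x` than `p`. The limit `t → 0` gives the claim. -/
theorem dist_sq_add_le_of_nearest (hX : IsCAT0 X) (hZ : IsGeodesicallyConvex Z)
    (hp : p ∈ nearest Z x) (hq : q ∈ Z) : dist x p ^ 2 + dist p q ^ 2 ≤ dist x q ^ 2 := by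
  have key : ∀ t : ℝ, 0 < t → t ≤ 1 → (1 - t) * dist p q ^ 2 ≤ dist x q ^ 2 - dist x p ^ 2 := by
    intro t ht0 ht1
    obtain ⟨z, hz⟩ := hX.exists_dividesAt p q ht0.le ht1
    have h1 := hX.dist_sq_le hz x
    have h2 : dist x p ≤ dist z x := by
      rw [hp.2, dist_comm]
      exact Metric.infDist_le_dist_of_mem (hZ p hp.1 q hq z hz.onSegment)
    have h3 : dist x p ^ 2 ≤ dist z x ^ 2 := by gcongr
    rw [dist_comm p x, dist_comm q x] at h1
    have h4 : t * ((1 - t) * dist p q ^ 2) ≤ t * (dist x q ^ 2 - dist x p ^ 2) := by nlinarith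
    exact le_of_mul_le_mul_left h4 ht0
  by_contra! hcon
  set D := dist p q ^ 2
  set E := dist x q ^ 2 - dist x p ^ 2
  have hE : 0 ≤ E := by simpa using key 1 one_pos le_rfl
  have hD : E < D := by linarith
  have h := key ((D - E) / (2 * D)) (by apply div_pos <;> linarith)
    (by rw [div_le_one (by linarith)]; linarith)
  have e : (1 - (D - E) / (2 * D)) * D = (D + E) / 2 := by
    have : D ≠ 0 := by linarith
    field_simp
    ring
  linarith

/-- The nearest point projection to a convex set is `1`-Lipschitz. -/
theorem dist_nearest_le (hX : IsCAT0 X) (hZ : IsGeodesicallyConvex Z) (hp : p ∈ nearest Z x)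
    (hq : q ∈ nearest Z y) : dist p q ≤ dist x y := by
  have h1 := hX.dist_sq_add_le_of_nearest hZ hp hq.1
  have h2 := hX.dist_sq_add_le_of_nearest hZ hq hp.1
  have h3 := hX.dist_sq_add_dist_sq_le x y p q
  rw [dist_comm q p] at h2
  exact le_of_sq_le_sq (by linarith) dist_nonneg

theorem nearest_unique (hX : IsCAT0 X) (hZ : IsGeodesicallyConvex Z) (hp : p ∈ nearest Z x)
    (hq : q ∈ nearest Z x) : p = q := by
  have := hX.dist_nearest_le hZ hp hq
  rw [dist_self] at this
  exact dist_le_zero.1 this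

/-- The distance to a convex set is quasi-convex along geodesics. -/
theorem infDist_le_max [ProperSpace X] (hX : IsCAT0 X) (hZc : IsClosed Z) (hne : Z.Nonempty)
    (hZ : IsGeodesicallyConvex Z) (h : OnSegment x y z) :
    Metric.infDist z Z ≤ max (Metric.infDist x Z) (Metric.infDist y Z) := by
  obtain ⟨t, ht⟩ := h.dividesAt
  obtain ⟨p, hp⟩ := nearest_nonempty hZc hne x
  obtain ⟨q, hq⟩ := nearest_nonempty hZc hne y
  -- The point dividing the segment of projections in the same ratio lies in `Z`, and the metric is
  -- convex.
  obtain ⟨v, hv⟩ := hX.exists_dividesAt p q ht.nonneg ht.le_one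
  have h1 := hX.dist_le_of_dividesAt ht hv
  have h2 := Metric.infDist_le_dist_of_mem (x := z) (hZ p hp.1 q hq.1 v hv.onSegment)
  rw [hp.2, hq.2] at h1
  have h3 := le_max_left (Metric.infDist x Z) (Metric.infDist y Z)
  have h4 := le_max_right (Metric.infDist x Z) (Metric.infDist y Z)
  nlinarith [ht.nonneg, ht.le_one]

/-- Geodesics are unique, so the one joining two points of the ray is a piece of the ray. -/
theorem isGeodesicallyConvex_range (hX : IsCAT0 X) {b : ℝ≥0 → X} (hb : Isometry b) :
    IsGeodesicallyConvex (range b) := by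
  have key : ∀ s t : ℝ≥0, s ≤ t → ∀ z, OnSegment (b s) (b t) z → z ∈ range b := by
    intro s t hst z hz
    obtain ⟨τ, hτ⟩ := hz.dividesAt
    lift τ to ℝ≥0 using hτ.nonneg
    refine ⟨s + τ * (t - s), (hX.dividesAt_unique hτ ⟨hτ.nonneg, hτ.le_one, ?_, ?_⟩).symm⟩
    all_goals
      have h1 : (s : ℝ) ≤ t := hst
      have h2 := hτ.le_one
      have h3 := hτ.nonneg
      rw [hb.dist_eq, hb.dist_eq, NNReal.dist_eq, NNReal.dist_eq]
      push_cast [NNReal.coe_sub hst]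
      rw [abs_sub_comm (s : ℝ) t, abs_of_nonneg (by linarith : (0 : ℝ) ≤ t - s)]
    · rw [abs_sub_comm, abs_of_nonneg (by nlinarith)]
      ring
    · rw [abs_sub_comm, abs_of_nonneg (by nlinarith)]
      ring
  rintro _ ⟨s, rfl⟩ _ ⟨t, rfl⟩ z hz
  rcases le_total s t with h | h
  · exact key s t h z hz
  · exact key t s h z hz.symm

end IsCAT0

/-! ### Detours at a definite height over a convex set. -/

/-- A geodesic from `a` to `b` of length at most `len` along which the distance to `Z` is at
least `height`. -/
def IsHighSegment {X : Type*} [MetricSpace X] (Z : Set X) (len height : ℝ) (a b : X) : Prop :=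
  dist a b ≤ len ∧ ∀ v, OnSegment a b v → height ≤ Metric.infDist v Z

section Detour

variable {X : Type*} [MetricSpace X] {Z : Set X}

/-- The detour rises over `m` to `w'` at height `l`, follows `[w', x]` up to `z`, crosses to the
point `z'` of `[p, x]` and descends towards `p`. Its ends project to `m` and `p`, so the
`1`-Lipschitz projection keeps them `l` apart. -/
theorem exists_detour_of_monotone (hX : IsCAT0 X) (hZ : IsGeodesicallyConvex Z)
    {x w p m : X} (hp : p ∈ nearest Z x) (hm : m ∈ nearest Z w) {l ε : ℝ} (hl : 0 < l)
    (hε : 0 < ε) (hε1 : ε ≤ 1) (hpm : l ≤ dist p m) (hpm' : dist p m ≤ 3 * l)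
    (hw : l ≤ Metric.infDist w Z)
    (hxw : ∀ v, OnSegment x w v → Metric.infDist w Z ≤ Metric.infDist v Z) :
    ∃ a₀ a₁ a₂ a₃ a₄ : X, Metric.infDist a₀ Z ≤ ε * l ∧ Metric.infDist a₄ Z ≤ ε * l ∧
      l ≤ dist a₀ a₄ ∧ dist m a₀ ≤ l ∧ IsHighSegment Z (10 * l) (ε * l) a₀ a₁ ∧
      IsHighSegment Z (10 * l) (ε * l) a₁ a₂ ∧ IsHighSegment Z (10 * l) (ε * l) a₂ a₃ ∧
      IsHighSegment Z (10 * l) (ε * l) a₃ a₄ := by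
  have hεl : 0 < ε * l := by positivity
  have hεl' : ε * l ≤ l := mul_le_of_le_one_left hl.le hε1
  have hlip : ∀ u v, Metric.infDist u Z - dist u v ≤ Metric.infDist v Z := fun u v => by
    linarith [Metric.infDist_le_infDist_add_dist (s := Z) (x := u) (y := v)]
  -- a point at height `c` below `u`
  have drop : ∀ u n : X, n ∈ nearest Z u → ∀ c, 0 < c → c ≤ Metric.infDist u Z →
      ∃ v, OnSegment n u v ∧ dist n v = c ∧ n ∈ nearest Z v ∧ Metric.infDist v Z = c ∧
        dist v u = Metric.infDist u Z - c := by
    intro u n hn c hc hcu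
    have hu : 0 < Metric.infDist u Z := hc.trans_le hcu
    have hnu : dist n u = Metric.infDist u Z := by rw [dist_comm, hn.2]
    obtain ⟨v, hv⟩ := hX.exists_dividesAt (t := c / Metric.infDist u Z) n u (by positivity)
      ((div_le_one hu).2 hcu)
    have h1 : dist n v = c := by rw [hv.left, hnu]; field_simp
    have h2 := nearest_of_onSegment hn hv.onSegment
    have h3 := hv.onSegment
    rw [OnSegment] at h3
    exact ⟨v, hv.onSegment, h1, h2, by rw [← h2.2, dist_comm, h1], by linarith⟩
  have hA := hxw x (by simp [OnSegment])
  set A := Metric.infDist x Z with hAdef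
  have hApos : 0 < A := by linarith
  have hpx : dist x p = A := hp.2
  obtain ⟨w', hw'1, hw'2, hw'3, hw'4, hw'5⟩ := drop w m hm l hl hw
  obtain ⟨a₀, ha1, ha2, ha3, ha4, ha5⟩ := drop w' m hw'3 (ε * l) hεl (by rw [hw'4]; exact hεl')
  -- Compare `[x, w']` with `[x, w]` from the apex `x`: matching points are no further apart than
  -- `w` and `w'`, which are `infDist w Z - l` apart.
  have hhigh : ∀ v, OnSegment w' x v → l ≤ Metric.infDist v Z := by
    intro v hv
    obtain ⟨t, ht⟩ := hv.symm.dividesAt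
    obtain ⟨u, hu⟩ := hX.exists_dividesAt x w ht.nonneg ht.le_one
    have h1 := hX.dist_le_of_apex hu ht
    have h2 := hxw u hu.onSegment
    have h3 := hlip u v
    rw [dist_comm w w', hw'5] at h1
    nlinarith [ht.nonneg, ht.le_one]
  have hw'p : dist w' p ≤ 4 * l := by
    have := dist_triangle w' m p
    rw [dist_comm w' m, dist_comm m p] at this
    linarith
  have hxw' : dist x w' ≤ A + 4 * l := by
    have := dist_triangle x p w'
    rw [dist_comm p w'] at this
    linarith
  -- The point `z'` will have height `min A (6 * l)`: either `s = 1` and `z`, `z'` are both `x`, or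
  -- the crossing, of length at most `4 * l`, ends at height `6 * l`.
  obtain ⟨s, hs0, hs1, hsA, hsA', hs⟩ : ∃ s : ℝ, 0 ≤ s ∧ s ≤ 1 ∧ s * A ≤ 6 * l ∧ l ≤ s * A ∧
      (s = 1 ∨ s * A = 6 * l) := by
    rcases le_total (6 * l) A with h | h
    · have e : 6 * l / A * A = 6 * l := by field_simp
      exact ⟨6 * l / A, by positivity, (div_le_one hApos).2 h, e.le, by linarith, Or.inr e⟩
    · exact ⟨1, zero_le_one, le_rfl, by linarith, by linarith, Or.inl rfl⟩
  obtain ⟨z, hz⟩ := hX.exists_dividesAt w' x hs0 hs1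
  obtain ⟨z', hz'⟩ := hX.exists_dividesAt p x hs0 hs1
  have hzz : dist z z' ≤ (1 - s) * (4 * l) := by
    refine (hX.dist_le_of_apex hz.symm hz'.symm).trans ?_
    gcongr
  have hz'p := nearest_of_onSegment hp hz'.onSegment
  have hz'h : Metric.infDist z' Z = s * A := by
    rw [← hz'p.2, dist_comm, hz'.left, dist_comm, hpx]
  obtain ⟨a₄, hb1, hb2, hb3, hb4, hb5⟩ := drop z' p hz'p (ε * l) hεl (by rw [hz'h]; linarith)
  refine ⟨a₀, w', z, z', a₄, ha4.le, hb4.le, ?_, by linarith, ⟨?_, fun v hv => ?_⟩,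
    ⟨?_, fun v hv => ?_⟩, ⟨?_, fun v hv => ?_⟩, ⟨?_, fun v hv => ?_⟩⟩
  · rw [dist_comm p m] at hpm
    exact hpm.trans (hX.dist_nearest_le hZ ha3 hb3)
  · rw [ha5, hw'4]
    linarith
  · have h1 := hlip w' v
    rw [OnSegment] at hv
    have h2 := dist_nonneg (x := a₀) (y := v)
    rw [dist_comm w' v] at h1
    linarith
  · rw [hz.left, dist_comm w' x]
    nlinarith
  · exact hεl'.trans (hhigh v (hz.onSegment.trans_left hv))
  · nlinarith
  · have h1 := hlip z' v
    rw [OnSegment] at hv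
    have h2 := dist_nonneg (x := z) (y := v)
    rw [dist_comm z' v] at h1
    rcases hs with rfl | h
    · linarith
    · nlinarith
  · rw [dist_comm, hb5, hz'h]
    linarith
  · have h1 := hlip z' v
    rw [OnSegment] at hv
    have h2 := dist_nonneg (x := v) (y := a₄)
    rw [dist_comm z' a₄] at hv
    linarith

/-- If `x` and `y` are no further apart than `x` is from the convex set `Z`, then the projections of
`x` and `y` to `Z` are joined by a detour through points far from `Z`, whose length is at most a
multiple of the distance `2 * l` of these projections. -/
theorem exists_detour [ProperSpace X] (hX : IsCAT0 X) (hZc : IsClosed Z)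
    (hZ : IsGeodesicallyConvex Z) {x y p q : X} (hp : p ∈ nearest Z x) (hq : q ∈ nearest Z y)
    (hxy : dist x y ≤ Metric.infDist x Z) {l ε : ℝ} (hl : 0 < l) (hpq : dist p q = 2 * l)
    (hε : 0 < ε) (hε1 : ε ≤ 1) :
    ∃ a₀ a₁ a₂ a₃ a₄ : X, Metric.infDist a₀ Z ≤ ε * l ∧ Metric.infDist a₄ Z ≤ ε * l ∧
      l ≤ dist a₀ a₄ ∧ dist p a₀ ≤ 4 * l ∧ IsHighSegment Z (10 * l) (ε * l) a₀ a₁ ∧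
      IsHighSegment Z (10 * l) (ε * l) a₁ a₂ ∧ IsHighSegment Z (10 * l) (ε * l) a₂ a₃ ∧
      IsHighSegment Z (10 * l) (ε * l) a₃ a₄ := by
  have hne : Z.Nonempty := ⟨p, hp.1⟩
  choose π hπ using nearest_nonempty hZc hne
  obtain ⟨c, hc0, hc1, hc⟩ := hX.geodesic x y
  have hd := dist_nonneg (x := x) (y := y)
  have hcont : ContinuousOn (fun τ => dist (π (c τ)) q) (Icc 0 (dist x y)) := by
    refine continuous_dist.comp_continuousOn (ContinuousOn.prodMk ?_ continuousOn_const)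
    refine (LipschitzOnWith.of_dist_le_mul (K := 1) fun s hs t ht => ?_).continuousOn
    rw [NNReal.coe_one, one_mul, Real.dist_eq, ← hc s hs t ht]
    exact hX.dist_nearest_le hZ (hπ _) (hπ _)
  -- Stop where the projection is at distance `l` from `q`. At least `l` of the way to `y` then
  -- remains, so the hypothesis on `dist x y` leaves `w` at height at least `l`.
  obtain ⟨τ, hτ, hτl⟩ := intermediate_value_Icc' hd hcont (by
    rw [hc0, hc1, hX.nearest_unique hZ (hπ x) hp, hX.nearest_unique hZ (hπ y) hq, hpq, dist_self]
    exact ⟨hl.le, by linarith⟩ : l ∈ Icc _ _)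
  dsimp only at hτl
  set w := c τ with hw
  have hm := hπ w
  set m := π w
  have hxw : dist x w = τ := by
    have := hc 0 ⟨le_rfl, hd⟩ τ hτ
    rwa [hc0, zero_sub, abs_neg, abs_of_nonneg hτ.1] at this
  have hwy : dist w y = dist x y - τ := by
    have := hc τ hτ (dist x y) ⟨hd, le_rfl⟩
    rwa [hc1, abs_sub_comm, abs_of_nonneg (by linarith [hτ.2])] at this
  have hlwy : l ≤ dist w y := by
    rw [← hτl]
    exact hX.dist_nearest_le hZ hm hq
  have hwl : l ≤ Metric.infDist w Z := by
    have := Metric.infDist_le_infDist_add_dist (s := Z) (x := x) (y := w)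
    linarith
  have hpm : l ≤ dist p m := by
    have := dist_triangle p m q
    linarith
  have hpm' : dist p m ≤ 3 * l := by
    have := dist_triangle p q m
    rw [dist_comm q m] at this
    linarith
  -- By quasi-convexity the height cannot drop below its value at `w` on both sides of `w`.
  have hdich : (∀ v, OnSegment x w v → Metric.infDist w Z ≤ Metric.infDist v Z) ∨
      ∀ v, OnSegment y w v → Metric.infDist w Z ≤ Metric.infDist v Z := by
    by_contra! hcon
    obtain ⟨⟨u, hu, hu'⟩, v, hv, hv'⟩ := hcon
    refine absurd (hX.infDist_le_max hZc hne hZ (x := u) (y := v) (z := w) ?_)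
      (not_le.2 (max_lt hu' hv'))
    rw [OnSegment] at *
    have h1 := dist_triangle4 x u v y
    have h2 := dist_triangle u w v
    rw [dist_comm v y] at h1
    rw [dist_comm v w, dist_comm y w] at hv
    linarith
  rcases hdich with h | h
  · obtain ⟨a₀, a₁, a₂, a₃, a₄, h1, h2, h3, h4, h5⟩ :=
      exists_detour_of_monotone hX hZ hp hm hl hε hε1 hpm hpm' hwl h
    refine ⟨a₀, a₁, a₂, a₃, a₄, h1, h2, h3, ?_, h5⟩
    linarith [dist_triangle p m a₀]
  · rw [dist_comm] at hτl
    obtain ⟨a₀, a₁, a₂, a₃, a₄, h1, h2, h3, h4, h5⟩ :=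
      exists_detour_of_monotone hX hZ hq hm hl hε hε1 hτl.ge (by linarith) hwl h
    refine ⟨a₀, a₁, a₂, a₃, a₄, h1, h2, h3, ?_, h5⟩
    linarith [dist_triangle p m a₀]

end Detour

/-! ### Contracting sets are strongly Morse. -/

section Contracting

variable {X : Type*} [MetricSpace X]

/-- `Z` is `κ`-contracting with constant `c`, in terms of individual nearest points. -/
structure ContractsWith (κ : SublinearFunction) (o : X) (Z : Set X) (c : ℝ) : Prop where
  nonneg : 0 ≤ c
  dist_le : ∀ {x y p q : X}, p ∈ nearest Z x → q ∈ nearest Z y → dist x y ≤ Metric.infDist x Z →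
    dist p q ≤ c * κ (dist o x)

theorem IsContracting.exists_contractsWith {κ : SublinearFunction} {o : X} {Z : Set X}
    (h : IsContracting κ o Z) : ∃ c, ContractsWith κ o Z c := by
  obtain ⟨c, hc⟩ := h
  refine ⟨|c|, abs_nonneg c, fun {x y p q} hp hq hxy => ?_⟩
  have hb : ∀ u : X, Bornology.IsBounded (nearest Z u) := fun u =>
    Metric.isBounded_closedBall.subset fun z hz => by
      rw [Metric.mem_closedBall, dist_comm]
      exact hz.2.le
  have h1 := Metric.dist_le_diam_of_mem ((hb x).union (hb y)) (Or.inl hp) (Or.inr hq)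
  have h2 := mul_le_mul_of_nonneg_right (le_abs_self c) (κ.pos (dist_nonneg (x := o) (y := x))).le
  linarith [hc x y hxy]

theorem ContractsWith.isContracting [ProperSpace X] {κ : SublinearFunction} {o : X} {Z : Set X}
    {c : ℝ} (h : ContractsWith κ o Z c) (hZ : IsClosed Z) (hne : Z.Nonempty) :
    IsContracting κ o Z := by
  refine ⟨2 * c, fun x y hxy => ?_⟩
  have hκ := κ.pos (dist_nonneg (x := o) (y := x))
  have hc := h.nonneg
  have hcκ : 0 ≤ c * κ (dist o x) := by positivity
  obtain ⟨p, hp⟩ := nearest_nonempty hZ hne x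
  have key : ∀ z ∈ nearest Z x ∪ nearest Z y, dist p z ≤ c * κ (dist o x) := by
    rintro z (hz | hz)
    · exact h.dist_le hp hz (by rw [dist_self]; exact Metric.infDist_nonneg)
    · exact h.dist_le hp hz hxy
  refine Metric.diam_le_of_forall_dist_le (by positivity) fun z hz w hw => ?_
  have := dist_triangle z p w
  rw [dist_comm z p] at this
  linarith [key z hz, key w hw]

/-- The points `ζ 0, …, ζ n` form a discrete `(q, Q)`-quasi-geodesic. -/
structure IsDiscreteQuasiGeodesic (q Q : ℝ) (n : ℕ) (ζ : ℕ → X) : Prop where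
  one_le : 1 ≤ q
  nonneg : 0 ≤ Q
  lower : ∀ i j : ℕ, i ≤ j → j ≤ n → 1 / q * ((j : ℝ) - i) - Q ≤ dist (ζ i) (ζ j)
  upper : ∀ i j : ℕ, i ≤ j → j ≤ n → dist (ζ i) (ζ j) ≤ q * ((j : ℝ) - i) + Q

namespace IsDiscreteQuasiGeodesic

variable {κ : SublinearFunction} {o : X} {Z : Set X} {c q Q D : ℝ} {n : ℕ} {ζ : ℕ → X}

theorem sub_le (h : IsDiscreteQuasiGeodesic q Q n ζ) {i j : ℕ} (hij : i ≤ j) (hj : j ≤ n) :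
    (j : ℝ) - i ≤ q * (dist (ζ i) (ζ j) + Q) := by
  have := h.lower i j hij hj
  rwa [one_div, sub_le_iff_le_add, inv_mul_le_iff₀ (by linarith [h.one_le])] at this

/-- Far from a contracting set, the nearest point projection of a quasi-geodesic moves slowly. -/
theorem sub_le_of_far [ProperSpace X] (h : IsDiscreteQuasiGeodesic q Q n ζ) (hZ : IsClosed Z)
    (hne : Z.Nonempty) (hc : ContractsWith κ o Z c) (hD : 2 * (Q + q) + 4 * q ^ 2 * c ≤ D)
    {s t : ℕ} (hst : s ≤ t) (htn : t ≤ n) {R : ℝ}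
    (hfar : ∀ i, s ≤ i → i ≤ t → D * κ (dist o (ζ i)) ≤ Metric.infDist (ζ i) Z)
    (hR : ∀ i, s ≤ i → i ≤ t → dist o (ζ i) ≤ R) :
    (t : ℝ) - s ≤
      2 * q * (Metric.infDist (ζ s) Z + Metric.infDist (ζ t) Z + Q + c * κ R) := by
  have hq := h.one_le
  have hQ := h.nonneg
  have hc0 := hc.nonneg
  have hq0 : 0 < q := by linarith
  choose π hπ using nearest_nonempty hZ hne
  -- Induction on the remaining time: each full jump moves the projection by at most the duration of
  -- the jump divided by `2 * q`; the last, incomplete jump accounts for `c * κ R`.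
  have key : ∀ d i : ℕ, s ≤ i → i ≤ t → t - i = d →
      2 * q * dist (π (ζ i)) (π (ζ t)) ≤ ((t : ℝ) - i) + 2 * q * (c * κ R) := by
    intro d
    induction d using Nat.strong_induction_on with
    | _ d ih =>
      intro i hsi hit hd
      have hκ := κ.one_le' _ (dist_nonneg (x := o) (y := ζ i))
      have hκR := κ.mono dist_nonneg (hR i hsi hit)
      have hi := hfar i hsi hit
      set H := Metric.infDist (ζ i) Z with hH
      have hDκ : (2 * (Q + q) + 4 * q ^ 2 * c) * κ (dist o (ζ i)) ≤ H :=
        (mul_le_mul_of_nonneg_right hD (by linarith)).trans hi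
      have hH1 : 2 * (Q + q) ≤ H := by
        have : 0 ≤ 4 * q ^ 2 * c * κ (dist o (ζ i)) := by positivity
        nlinarith
      have hH2 : 4 * q ^ 2 * c * κ (dist o (ζ i)) ≤ H := by
        have : 0 ≤ 2 * (Q + q) * κ (dist o (ζ i)) := by positivity
        nlinarith
      -- The longest jump to which contraction at `ζ i` surely applies. The two parts of `D` make it
      -- long: `H ≤ 2 * q * a`, and `2 * q` times the motion of the projection is at most `a`.
      set a := ⌊(H - Q) / q⌋₊ with ha
      have ha1 : q * a + Q ≤ H := by
        have : (a : ℝ) ≤ (H - Q) / q := Nat.floor_le (div_nonneg (by linarith) hq0.le)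
        rw [le_div_iff₀ hq0] at this
        linarith
      have ha2 : H ≤ 2 * (q * a) := by
        have : (H - Q) / q < a + 1 := Nat.lt_floor_add_one _
        rw [div_lt_iff₀ hq0] at this
        linarith
      have hcκ : 2 * q * (c * κ (dist o (ζ i))) ≤ a := by
        have : q * (2 * (2 * q * (c * κ (dist o (ζ i))))) ≤ q * (2 * a) := by nlinarith
        have := le_of_mul_le_mul_left this hq0
        linarith
      have hclose : ∀ j, i ≤ j → j ≤ t → j - i ≤ a →
          dist (π (ζ i)) (π (ζ j)) ≤ c * κ (dist o (ζ i)) := by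
        intro j hij hjt hja
        refine hc.dist_le (hπ _) (hπ _) ((h.upper i j hij (hjt.trans htn)).trans ?_)
        have : (j : ℝ) - i ≤ a := by
          rw [← Nat.cast_sub hij]
          exact_mod_cast hja
        nlinarith
      rcases le_or_gt (t - i) a with hta | hta
      · have h1 := hclose t hit le_rfl hta
        have h2 : (0 : ℝ) ≤ (t : ℝ) - i := by
          rw [sub_nonneg]
          exact_mod_cast hit
        have h3 : c * κ (dist o (ζ i)) ≤ c * κ R := by gcongr
        nlinarith
      · have ha0 : 0 < a := by
          rcases Nat.eq_zero_or_pos a with h0 | h0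
          · rw [h0, Nat.cast_zero] at ha2
            linarith
          · exact h0
        have h1 := hclose (i + a) (by omega) (by omega) (by omega)
        have h2 := ih (t - (i + a)) (by omega) (i + a) (by omega) (by omega) rfl
        have h3 := dist_triangle (π (ζ i)) (π (ζ (i + a))) (π (ζ t))
        push_cast at h2
        nlinarith
  have h1 := key _ s le_rfl hst rfl
  have h2 := h.sub_le hst htn
  have h3 := dist_triangle4 (ζ s) (π (ζ s)) (π (ζ t)) (ζ t)
  rw [(hπ (ζ s)).2, dist_comm (π (ζ t)), (hπ (ζ t)).2] at h3
  have h4 : q * (dist (ζ s) (ζ t) + Q) ≤ q * (Metric.infDist (ζ s) Z +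
      dist (π (ζ s)) (π (ζ t)) + Metric.infDist (ζ t) Z + Q) := by gcongr
  nlinarith

/-- A quasi-geodesic starting near a contracting set stays near it, unless it ends far from it
after an excursion whose length is controlled. -/
theorem exists_infDist_le_or (κ : SublinearFunction) (q Q c D : ℝ) (hq : 1 ≤ q) (hQ : 0 ≤ Q)
    (hc0 : 0 ≤ c) (hD : 2 * (Q + q) + 4 * q ^ 2 * c ≤ D) :
    ∃ M, 0 ≤ M ∧ ∀ {X : Type*} [MetricSpace X] [ProperSpace X] {o : X} {Z : Set X} {n : ℕ}
      {ζ : ℕ → X}, IsClosed Z → Z.Nonempty → ContractsWith κ o Z c →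
      IsDiscreteQuasiGeodesic q Q n ζ → Metric.infDist (ζ 0) Z ≤ D * κ (dist o (ζ 0)) →
      ∀ i ≤ n, Metric.infDist (ζ i) Z ≤ M * κ (dist o (ζ i)) ∨
        (D * κ (dist o (ζ n)) < Metric.infDist (ζ n) Z ∧ ∀ R, (∀ j ≤ n, dist o (ζ j) ≤ R) →
          (n : ℝ) - i ≤ 2 * q * (2 * Q + q + Metric.infDist (ζ n) Z + (D + c) * κ R)) := by
  have hD0 : 0 ≤ D := le_trans (by positivity) hD
  -- In units of `κ R`, `A₁` bounds the duration of an excursion, with `2` for the steps of leaving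
  -- and returning, and `A₂` bounds its diameter.
  set A₁ := 2 * q * (2 * (D + q + Q) + Q + c) + 2 with hA₁
  have hA₁0 : 0 ≤ A₁ := by positivity
  set A₂ := q * A₁ + Q with hA₂
  have hA₂0 : 0 ≤ A₂ := by positivity
  obtain ⟨B, hB1, hB⟩ := κ.exists_absorb A₂
  refine ⟨(D + A₂) * B, by positivity, fun {X} _ _ {o Z n ζ} hZ hne hc h h0 i hi => ?_⟩
  by_cases hiD : Metric.infDist (ζ i) Z ≤ D * κ (dist o (ζ i))
  · left
    have : D ≤ (D + A₂) * B := by nlinarith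
    exact hiD.trans (mul_le_mul_of_nonneg_right this (κ.pos dist_nonneg).le)
  classical
  set s := Nat.findGreatest (fun j => Metric.infDist (ζ j) Z ≤ D * κ (dist o (ζ j))) i with hs
  have hsP : Metric.infDist (ζ s) Z ≤ D * κ (dist o (ζ s)) :=
    Nat.findGreatest_spec (P := fun j => Metric.infDist (ζ j) Z ≤ D * κ (dist o (ζ j)))
      (Nat.zero_le i) h0
  have hsi : s < i := lt_of_le_of_ne (Nat.findGreatest_le i) fun e => hiD (e ▸ hsP)
  have hsfar : ∀ j, s < j → j ≤ i → D * κ (dist o (ζ j)) < Metric.infDist (ζ j) Z :=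
    fun j hj hji => not_le.1 (Nat.findGreatest_is_greatest hj hji)
  have hnext : ∀ j, j + 1 ≤ n → dist (ζ j) (ζ (j + 1)) ≤ q + Q := fun j hj => by
    have := h.upper j (j + 1) (by omega) hj
    push_cast at this
    linarith
  have hs1 : Metric.infDist (ζ (s + 1)) Z ≤ D * κ (dist o (ζ s)) + q + Q := by
    have h1 := Metric.infDist_le_infDist_add_dist (s := Z) (x := ζ (s + 1)) (y := ζ s)
    have h2 := hnext s (by omega)
    rw [dist_comm] at h2
    linarith
  by_cases hex : ∃ j, i ≤ j ∧ j ≤ n ∧ Metric.infDist (ζ j) Z ≤ D * κ (dist o (ζ j))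
  · left
    set t := Nat.find hex with ht
    obtain ⟨hit, htn, htP⟩ := Nat.find_spec hex
    rw [← ht] at hit htn htP
    have hit' : i < t := lt_of_le_of_ne hit fun e => hiD (e ▸ htP)
    have htfar : ∀ j, i ≤ j → j < t → D * κ (dist o (ζ j)) < Metric.infDist (ζ j) Z :=
      fun j hij hjt => not_le.1 fun hj => Nat.find_min hex hjt ⟨hij, by omega, hj⟩
    -- The largest norm `R` is attained on the excursion, within `A₂ * κ R` of `ζ i`, so `κ R` is
    -- absorbed by `κ` at `ζ i`.
    obtain ⟨v, hv, hvmax⟩ := Finset.exists_max_image (Finset.Icc s t) (fun j => dist o (ζ j))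
      ⟨s, by simp; omega⟩
    rw [Finset.mem_Icc] at hv
    set R := dist o (ζ v) with hR
    have hR' : ∀ j, s ≤ j → j ≤ t → dist o (ζ j) ≤ R := fun j h1 h2 =>
      hvmax j (Finset.mem_Icc.2 ⟨h1, h2⟩)
    have hκR := κ.one_le' R dist_nonneg
    have hlast : Metric.infDist (ζ (t - 1)) Z ≤ D * κ (dist o (ζ t)) + q + Q := by
      have h1 := Metric.infDist_le_infDist_add_dist (s := Z) (x := ζ (t - 1)) (y := ζ t)
      have h2 := hnext (t - 1) (by omega)
      rw [show t - 1 + 1 = t by omega] at h2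
      linarith
    have h1 := h.sub_le_of_far hZ hne hc hD (s := s + 1) (t := t - 1) (by omega) (by omega)
      (R := R) (fun j hj hj' => by
        rcases le_total j i with hji | hji
        · exact (hsfar j (by omega) hji).le
        · exact (htfar j hji (by omega)).le)
      (fun j hj hj' => hR' j (by omega) (by omega))
    rw [Nat.cast_sub (by omega : 1 ≤ t)] at h1
    push_cast at h1
    have hκs : D * κ (dist o (ζ s)) ≤ D * κ R := by
      gcongr
      exact κ.mono dist_nonneg (hR' s le_rfl (by omega))
    have hκt : D * κ (dist o (ζ t)) ≤ D * κ R := by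
      gcongr
      exact κ.mono dist_nonneg (hR' t (by omega) le_rfl)
    have hlen : (t : ℝ) - s ≤ A₁ * κ R := by
      have e1 : q + Q ≤ (q + Q) * κ R := le_mul_of_one_le_right (by linarith) hκR
      have e2 : Q ≤ Q * κ R := le_mul_of_one_le_right hQ hκR
      have e3 : 2 * q * (Metric.infDist (ζ (s + 1)) Z + Metric.infDist (ζ (t - 1)) Z + Q +
          c * κ R) ≤ 2 * q * ((2 * (D + q + Q) + Q + c) * κ R) := by
        gcongr
        linarith
      rw [hA₁]
      linarith
    have hdist : ∀ j k, s ≤ j → j ≤ k → k ≤ t → dist (ζ j) (ζ k) ≤ A₂ * κ R := by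
      intro j k hj hjk hk
      refine (h.upper j k hjk (by omega)).trans ?_
      have e1 : (j : ℝ) ≥ s := by exact_mod_cast hj
      have e2 : (k : ℝ) ≤ t := by exact_mod_cast hk
      have e3 : q * ((k : ℝ) - j) ≤ q * (A₁ * κ R) := by
        gcongr
        linarith
      have e4 : Q ≤ Q * κ R := le_mul_of_one_le_right hQ hκR
      rw [hA₂]
      linarith
    have hvi : dist (ζ i) (ζ v) ≤ A₂ * κ R := by
      rcases le_total i v with hiv | hiv
      · exact hdist i v hsi.le hiv hv.2
      · rw [dist_comm]
        exact hdist v i hv.1 hiv hit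
    have hκRi := hB R (dist o (ζ i)) dist_nonneg dist_nonneg
      ((dist_triangle o (ζ i) (ζ v)).trans (by linarith))
    have h2 := Metric.infDist_le_infDist_add_dist (s := Z) (x := ζ i) (y := ζ s)
    rw [dist_comm] at h2
    calc Metric.infDist (ζ i) Z ≤ (D + A₂) * κ R := by linarith [hdist s i le_rfl hsi.le hit]
      _ ≤ (D + A₂) * (B * κ (dist o (ζ i))) := by gcongr
      _ = (D + A₂) * B * κ (dist o (ζ i)) := by ring
  · right
    push Not at hex
    refine ⟨hex n hi le_rfl, fun R hR => ?_⟩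
    have h1 := h.sub_le_of_far hZ hne hc hD (s := s + 1) (t := n) (by omega) le_rfl
      (R := R) (fun j hj hj' => by
        rcases le_total j i with hji | hji
        · exact (hsfar j (by omega) hji).le
        · exact (hex j hji hj').le)
      (fun j hj hj' => hR j hj')
    have hκs : D * κ (dist o (ζ s)) ≤ D * κ R := by
      gcongr
      exact κ.mono dist_nonneg (hR s (by omega))
    have h2 : ((s + 1 : ℕ) : ℝ) ≤ i := by exact_mod_cast hsi
    have h3 : 2 * q * (Metric.infDist (ζ (s + 1)) Z + Metric.infDist (ζ n) Z + Q + c * κ R) ≤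
        2 * q * (2 * Q + q + Metric.infDist (ζ n) Z + (D + c) * κ R) :=
      mul_le_mul_of_nonneg_left (by linarith) (by positivity)
    linarith

end IsDiscreteQuasiGeodesic

theorem isClosed_range [ProperSpace X] {o : X} (β : QuasiGeodesicRay o) :
    IsClosed (range β) := by
  obtain ⟨q, Q, hβ⟩ := β.quasi'
  have hq := hβ.one_le
  refine isClosed_of_closure_subset fun x hx => ?_
  set T := Real.toNNReal (q * (dist o x + 1 + Q))
  have hK : IsClosed (β '' Icc 0 T) := (isCompact_Icc.image β.continuous').isClosed
  refine image_subset_range β (Icc 0 T) (hK.closure_subset (Metric.mem_closure_iff.2 fun ε hε => ?_))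
  obtain ⟨_, ⟨t, rfl⟩, ht⟩ := Metric.mem_closure_iff.1 hx (min ε 1) (by positivity)
  refine ⟨β t, ⟨t, ⟨zero_le, ?_⟩, rfl⟩, ht.trans_le (min_le_left _ _)⟩
  refine NNReal.le_toNNReal_of_coe_le ((hβ.le_norm t).trans ?_)
  gcongr
  linarith [dist_triangle o x (β t), min_le_right ε 1]

theorem firstTime_le {o : X} (β : QuasiGeodesicRay o) {r : ℝ} (hr : 0 ≤ r) {t : ℝ≥0}
    (h : r ≤ dist o (β t)) : firstTime β r ≤ t := by
  obtain ⟨u, hu, e⟩ := exists_norm_eq β hr t h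
  exact (csInf_le (OrderBot.bddBelow _) e : firstTime β r ≤ u).trans hu

theorem norm_le_of_le_firstTime {o : X} (β : QuasiGeodesicRay o) {r : ℝ} (hr : 0 ≤ r) {t : ℝ≥0}
    (h : t ≤ firstTime β r) : dist o (β t) ≤ r := by
  by_contra! hcon
  have e := le_antisymm h (firstTime_le β hr hcon.le)
  rw [e, dist_firstTime β hr] at hcon
  exact lt_irrefl _ hcon

theorem IsQIRay.isDiscreteQuasiGeodesic {q Q : ℝ} {β : ℝ≥0 → X} (h : IsQIRay q Q β) (n : ℕ) :
    IsDiscreteQuasiGeodesic q Q n fun j => β j := by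
  have e : ∀ i j : ℕ, i ≤ j → dist (i : ℝ≥0) (j : ℝ≥0) = (j : ℝ) - i := fun i j hij => by
    have : (i : ℝ) ≤ j := by exact_mod_cast hij
    rw [dist_comm, NNReal.dist_eq]
    push_cast
    exact abs_of_nonneg (by linarith)
  refine ⟨h.one_le, h.nonneg, fun i j hij _ => ?_, fun i j hij _ => ?_⟩
  · rw [← e i j hij]; exact h.lower _ _
  · rw [← e i j hij]; exact h.upper _ _

/-- Both properties come from the dichotomy `exists_infDist_le_or` for integer samples. The second
alternative is excluded by an end near `Z` in the first property, and by an excursion too short to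
go back from radius `R` to radius `r` in the second. -/
theorem exists_strongMorseGauge [ProperSpace X] {κ : SublinearFunction} {o : X} {Z : Set X}
    (hZ : IsClosed Z) (ho : o ∈ Z) (hcon : IsContracting κ o Z) :
    ∃ m, IsStrongMorseGauge κ o Z m := by
  obtain ⟨c, hc⟩ := hcon.exists_contractsWith
  have hc0 := hc.nonneg
  have hne : Z.Nonempty := ⟨o, ho⟩
  have hκ1 := κ.one_le' 1 zero_le_one
  -- The dichotomy needs only `2 * (Q + q)`; the spare `Q + q` makes the last integer sample before
  -- an endpoint on `Z` count as near.
  set D : ℝ → ℝ → ℝ := fun q Q => 3 * (Q + q) + 4 * q ^ 2 * c with hDdef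
  have hex : ∀ q Q : ℝ, ∃ M, 1 ≤ q → 0 ≤ Q → 0 ≤ M ∧ ∀ {n : ℕ}
      {ζ : ℕ → X},
      IsDiscreteQuasiGeodesic q Q n ζ → Metric.infDist (ζ 0) Z ≤ D q Q * κ (dist o (ζ 0)) →
      ∀ i ≤ n, Metric.infDist (ζ i) Z ≤ M * κ (dist o (ζ i)) ∨
        (D q Q * κ (dist o (ζ n)) < Metric.infDist (ζ n) Z ∧ ∀ R, (∀ j ≤ n, dist o (ζ j) ≤ R) →
          (n : ℝ) - i ≤
            2 * q * (2 * Q + q + Metric.infDist (ζ n) Z + (D q Q + c) * κ R)) := by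
    intro q Q
    by_cases h : 1 ≤ q ∧ 0 ≤ Q
    · obtain ⟨M, hM0, hM⟩ := IsDiscreteQuasiGeodesic.exists_infDist_le_or κ q Q c (D q Q) h.1 h.2
        hc0 (by rw [hDdef]; dsimp only; linarith [h.1, h.2])
      exact ⟨M, fun _ _ => ⟨hM0, fun {n ζ} h1 h2 => hM hZ hne hc h1 h2⟩⟩
    · exact ⟨0, fun h1 h2 => absurd ⟨h1, h2⟩ h⟩
  choose M hM using hex
  set m : ℝ → ℝ → ℝ := fun q Q =>
    max (max q Q) (q + Q + M q Q * ((1 + (q + Q)) * κ 1)) with hm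
  -- passing from a point of the discrete quasi-geodesic to a nearby one
  have hpass : ∀ {q Q : ℝ} {x y : X}, 1 ≤ q → 0 ≤ Q → dist x y ≤ q + Q →
      Metric.infDist y Z ≤ M q Q * κ (dist o y) → x ∈ nbhd κ o Z (m q Q) := by
    intro q Q x y hq hQ hxy hy
    have hM0 := (hM q Q hq hQ).1
    have h1 := Metric.infDist_le_infDist_add_dist (s := Z) (x := x) (y := y)
    have h2 : κ (dist o y) ≤ (1 + (q + Q)) * κ 1 * κ (dist o x) := by
      refine (κ.mono dist_nonneg ?_).trans (κ.map_affine_le le_rfl (by positivity) dist_nonneg)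
      linarith [dist_triangle o x y]
    have hκx := κ.one_le' _ (dist_nonneg (x := o) (y := x))
    have h3 : M q Q * κ (dist o y) ≤ M q Q * ((1 + (q + Q)) * κ 1 * κ (dist o x)) := by gcongr
    have h4 : q + Q ≤ (q + Q) * κ (dist o x) := le_mul_of_one_le_right (by linarith) hκx
    have h5 : (q + Q + M q Q * ((1 + (q + Q)) * κ 1)) * κ (dist o x) ≤
        m q Q * κ (dist o x) := mul_le_mul_of_nonneg_right (le_max_right _ _) (by linarith)
    change Metric.infDist x Z ≤ m q Q * κ (dist o x)
    linarith
  have hDle : ∀ {q Q : ℝ}, 1 ≤ q → 0 ≤ Q → 0 ≤ D q Q ∧ q + Q ≤ D q Q := by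
    intro q Q hq hQ
    have : 0 ≤ 4 * q ^ 2 * c := by positivity
    rw [hDdef]
    constructor <;> dsimp only <;> linarith
  refine ⟨m, ⟨fun q Q _ _ => le_max_left _ _, ?_⟩, ?_⟩
  · rintro q Q s t ζ hζ hs ht _ ⟨u, hu, rfl⟩
    have hq := hζ.one_le
    have hQ := hζ.nonneg
    have hst := hζ.le
    set n := ⌊t - s⌋₊ with hn
    have hnle : (n : ℝ) ≤ t - s := Nat.floor_le (by linarith)
    have hmem : ∀ j : ℕ, j ≤ n → s + j ∈ Icc s t := fun j hj => by
      have : (j : ℝ) ≤ n := by exact_mod_cast hj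
      constructor <;> [linarith [Nat.cast_nonneg (α := ℝ) j]; linarith]
    have hclose : ∀ v ∈ Icc s t, ∀ j : ℕ, j ≤ n → s + j ≤ v → v ≤ s + j + 1 →
        dist (ζ v) (ζ (s + j)) ≤ q + Q := by
      intro v hv j hj h1 h2
      refine (hζ.upper v hv _ (hmem j hj)).trans ?_
      rw [abs_of_nonneg (by linarith)]
      nlinarith
    have hd : IsDiscreteQuasiGeodesic q Q n fun j => ζ (s + j) := by
      refine ⟨hq, hQ, fun i j hij hj => ?_, fun i j hij hj => ?_⟩
      all_goals
        have e : |s + i - (s + j)| = (j : ℝ) - i := by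
          have : (i : ℝ) ≤ j := by exact_mod_cast hij
          rw [abs_sub_comm, abs_of_nonneg (by linarith)]
          ring
        rw [← e]
      · exact hζ.lower _ (hmem i (hij.trans hj)) _ (hmem j hj)
      · exact hζ.upper _ (hmem i (hij.trans hj)) _ (hmem j hj)
    have hD := hDle hq hQ
    set i := ⌊u - s⌋₊ with hi
    have h1 : (i : ℝ) ≤ u - s := Nat.floor_le (by linarith [hu.1])
    have h2 : u - s < i + 1 := Nat.lt_floor_add_one _
    have hin : i ≤ n := Nat.floor_le_floor (by linarith [hu.2])
    refine hpass hq hQ (hclose u hu i hin (by linarith) (by linarith)) ?_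
    rcases (hM q Q hq hQ).2 hd (by
      rw [Nat.cast_zero, add_zero, Metric.infDist_zero_of_mem hs]
      exact mul_nonneg hD.1 (κ.pos dist_nonneg).le) i hin with h | h
    · exact h
    · exfalso
      have h3 := hclose t ⟨hst, le_rfl⟩ n le_rfl (by linarith)
        (by linarith [Nat.lt_floor_add_one (t - s)])
      rw [dist_comm] at h3
      have h4 := Metric.infDist_le_dist_of_mem (x := ζ (s + n)) ht
      have h5 : D q Q ≤ D q Q * κ (dist o (ζ (s + n))) :=
        le_mul_of_one_le_right hD.1 (κ.one_le' _ dist_nonneg)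
      have h6 := h.1
      linarith
  · intro r n κ' hr hn
    set D₁ := 3 * (r + r) + 4 * r ^ 2 * c with hD₁
    have hD₁0 : 0 ≤ D₁ := by positivity
    obtain ⟨T₁, hT₁, h₁⟩ := κ.exists_mul_le (4 * (2 * r ^ 2 * (D₁ + c)))
    obtain ⟨T₂, hT₂, h₂⟩ := κ'.exists_mul_le (4 * (2 * r ^ 2 * n))
    -- Smallness bounds `q` and `Q` by `r`, so `R` can be chosen uniformly. An excursion from radius
    -- `r` to `R` would give `R ≤ 3 * r + 2 * r ^ 2 * (5 * r)` plus a `κ` term and a `κ'` term, each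
    -- at most `R / 4`.
    set R := T₁ + T₂ + r + 4 * (3 * r + 2 * r ^ 2 * (5 * r)) with hR
    have hr3 : 0 ≤ r ^ 2 * (5 * r) := by positivity
    have hR0 : 0 < R := by linarith
    refine ⟨R, hR0, fun q Q η hη hsm hclose => ?_⟩
    have hq := hη.one_le
    have hQ := hη.nonneg
    have hmr : m q Q ≤ r := by
      refine hsm.trans (div_le_self hr.le ?_)
      linarith [κ.one_le' r hr.le]
    have hqr : q ≤ r := ((le_max_left _ _).trans (le_max_left _ _)).trans hmr
    have hQr : Q ≤ r := ((le_max_right _ _).trans (le_max_left _ _)).trans hmr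
    have hD := hDle hq hQ
    rintro _ ⟨u, hu, rfl⟩
    have hrR : r ≤ R := by linarith
    set t := firstTime η R with ht
    have hut : u ≤ t := by
      refine (mem_Iic.1 hu).trans (firstTime_le η hr.le ?_)
      rw [dist_firstTime η hR0.le]
      exact hrR
    have hfl : ∀ v : ℝ≥0, dist (η v) (η (⌊v⌋₊ : ℝ≥0)) ≤ q + Q := fun v => by
      have h1 : ((⌊v⌋₊ : ℝ≥0) : ℝ) ≤ v := NNReal.coe_le_coe.2 (Nat.floor_le zero_le)
      have h2 : (v : ℝ) < ((⌊v⌋₊ + 1 : ℝ≥0) : ℝ) := NNReal.coe_lt_coe.2 (Nat.lt_floor_add_one v)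
      rw [NNReal.coe_add, NNReal.coe_one] at h2
      refine (hη.upper _ _).trans ?_
      rw [NNReal.dist_eq, abs_of_nonneg (by linarith)]
      nlinarith
    refine hpass hq hQ (hfl u) ?_
    rcases (hM q Q hq hQ).2 (hη.isDiscreteQuasiGeodesic ⌊t⌋₊) (by
      rw [Nat.cast_zero, η.start', Metric.infDist_zero_of_mem ho]
      exact mul_nonneg hD.1 (κ.pos dist_nonneg).le) ⌊u⌋₊ (Nat.floor_le_floor hut) with h | h
    · exact h
    · exfalso
      have h3 := h.2 R fun j hj => norm_le_of_le_firstTime η hR0.le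
        ((Nat.cast_le.2 hj).trans (Nat.floor_le zero_le))
      have h4 := Metric.infDist_le_infDist_add_dist (s := Z) (x := η (⌊t⌋₊ : ℝ≥0)) (y := η t)
      rw [dist_comm] at h4
      have h5 := hfl t
      have h6 := hη.upper u t
      have h7 : R - r ≤ dist (η u) (η t) := by
        have e1 := dist_triangle o (η u) (η t)
        rw [ht, dist_firstTime η hR0.le, ← ht] at e1
        have e2 := norm_le_of_le_firstTime η hr.le hu
        linarith
      have h8 : dist u t ≤ (⌊t⌋₊ : ℝ) + 1 - ⌊u⌋₊ := by
        have e1 : ((⌊u⌋₊ : ℝ≥0) : ℝ) ≤ u := NNReal.coe_le_coe.2 (Nat.floor_le zero_le)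
        have e2 : (t : ℝ) < ((⌊t⌋₊ + 1 : ℝ≥0) : ℝ) :=
          NNReal.coe_lt_coe.2 (Nat.lt_floor_add_one t)
        have e3 : (u : ℝ) ≤ t := hut
        push_cast at e1 e2
        rw [dist_comm, NNReal.dist_eq, abs_of_nonneg (by linarith)]
        linarith
      have hκ0 := κ.pos hR0.le
      have hκ'0 := κ'.pos hR0.le
      have hDD₁ : D q Q ≤ D₁ := by
        rw [hDdef, hD₁]
        dsimp only
        gcongr
      have h9 : 2 * q * (2 * Q + q + Metric.infDist (η (⌊t⌋₊ : ℝ≥0)) Z + (D q Q + c) * κ R) ≤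
          2 * r * (5 * r + n * κ' R + (D₁ + c) * κ R) := by
        have e1 : (D q Q + c) * κ R ≤ (D₁ + c) * κ R := by gcongr
        have e2 : 0 ≤ (D q Q + c) * κ R := mul_nonneg (by linarith) hκ0.le
        have e3 : 0 ≤ Metric.infDist (η (⌊t⌋₊ : ℝ≥0)) Z := Metric.infDist_nonneg
        gcongr ?_ * ?_
        · linarith
        · linarith
      have h10 : q * dist u t ≤ r * (2 * r * (5 * r + n * κ' R + (D₁ + c) * κ R) + 1) := by
        gcongr
        linarith
      have h11 := h₁ R (by linarith)
      have h12 := h₂ R (by linarith)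
      nlinarith

end Contracting

/-! ### Images of contracting rays under quasi-isometries. -/

theorem exists_map_norm_le (κ : SublinearFunction) {X Y : Type*} [MetricSpace X] [MetricSpace Y]
    (oX : X) (oY : Y) {f : Y → X} {k K : ℝ} (hk : 1 ≤ k) (hK : 0 ≤ K)
    (hf : ∀ y y', dist (f y) (f y') ≤ k * dist y y' + K) :
    ∃ B, 0 ≤ B ∧ ∀ y, κ (dist oX (f y)) ≤ B * κ (dist oY y) := by
  have h1 := κ.one_le' 1 zero_le_one
  refine ⟨(k + (K + dist oX (f oY))) * κ 1, by positivity, fun y => ?_⟩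
  refine (κ.mono dist_nonneg ?_).trans (κ.map_affine_le hk (by positivity) dist_nonneg)
  linarith [dist_triangle oX (f oY) (f y), hf oY y]

/-- Geodesics from the base-point to the points of a ray which stay uniformly close to the ray
converge to a geodesic ray close to it. -/
theorem exists_geodesic_ray {Y : Type*} [MetricSpace Y] [ProperSpace Y] {κ : SublinearFunction}
    {o : Y} (γ : QuasiGeodesicRay o) {M : ℝ}
    (hM : ∀ n : ℕ, ∃ c : ℝ → Y, c 0 = o ∧
      (∀ s ∈ Icc 0 (dist o (γ n)), ∀ t ∈ Icc 0 (dist o (γ n)), dist (c s) (c t) = |s - t|) ∧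
      ∀ t ∈ Icc 0 (dist o (γ n)), Metric.infDist (c t) (range γ) ≤ M * κ t) :
    ∃ b : QuasiGeodesicRay o, Isometry b ∧ range b ⊆ nbhd κ o (range γ) M := by
  choose c hc0 hcd hcM using hM
  obtain ⟨q, Q, hγ⟩ := γ.quasi'
  have hq := hγ.one_le
  -- Outside this interval `c n` is arbitrary, so each `t` is controlled only for large `n`.
  have hev : ∀ t : ℝ≥0, ∀ᶠ n : ℕ in (hyperfilter ℕ : Filter ℕ), (t : ℝ) ∈ Icc 0 (dist o (γ n)) := by
    intro t
    have h : ∀ᶠ n : ℕ in atTop, (t : ℝ) ∈ Icc 0 (dist o (γ n)) := by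
      filter_upwards [eventually_ge_atTop ⌈q * (t + Q)⌉₊] with n hn
      refine ⟨t.2, ?_⟩
      have h1 : q * (t + Q) ≤ n := (Nat.le_ceil _).trans (by exact_mod_cast hn)
      have h2 := hγ.le_norm n
      rw [NNReal.coe_natCast] at h2
      have := le_of_mul_le_mul_left (h1.trans h2) (by linarith)
      linarith
    exact h.filter_mono Nat.hyperfilter_le_atTop
  -- A single ultrafilter gives limits for all `t` at once, without a diagonal argument.
  have hlim : ∀ t : ℝ≥0, ∃ x, Tendsto (fun n => c n t) (hyperfilter ℕ : Filter ℕ) (𝓝 x) := by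
    intro t
    obtain ⟨x, -, hx⟩ := (isCompact_closedBall o (t : ℝ)).ultrafilter_le_nhds'
      ((hyperfilter ℕ).map fun n => c n t) (by
        rw [Ultrafilter.mem_map]
        filter_upwards [hev t] with n hn
        rw [mem_preimage, Metric.mem_closedBall, ← hc0 n,
          hcd n t hn 0 ⟨le_rfl, dist_nonneg⟩, sub_zero, NNReal.abs_eq])
    exact ⟨x, hx⟩
  choose b hb using hlim
  have hiso : Isometry b := Isometry.of_dist_eq fun s t => by
    refine tendsto_nhds_unique ((hb s).dist (hb t)) (tendsto_const_nhds.congr' ?_)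
    filter_upwards [hev s, hev t] with n hs ht
    rw [hcd n s hs t ht, NNReal.dist_eq]
  have hb0 : b 0 = o := by
    refine tendsto_nhds_unique (hb 0) ?_
    simp only [NNReal.coe_zero, hc0]
    exact tendsto_const_nhds
  refine ⟨⟨b, hiso.continuous, hb0, 1, 0, le_rfl, le_rfl, fun s t => ?_, fun s t => ?_⟩, hiso, ?_⟩
  · rw [hiso.dist_eq]; simp
  · rw [hiso.dist_eq]; simp
  · rintro _ ⟨t, rfl⟩
    have hn : dist o (b t) = t := by
      rw [← hb0, hiso.dist_eq, dist_comm, NNReal.dist_eq, NNReal.coe_zero, sub_zero,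
        NNReal.abs_eq]
    change Metric.infDist (b t) (range γ) ≤ M * κ (dist o (b t))
    rw [hn]
    refine le_of_tendsto (((Metric.continuous_infDist_pt (range γ)).tendsto _).comp (hb t)) ?_
    filter_upwards [hev t] with n ht
    exact hcM n t ht

section Transfer

variable {X Y : Type*} [MetricSpace X] [MetricSpace Y] {oX : X} {oY : Y}
  {k K : ℝ} {Φ : X → Y} {Ψ : Y → X} {κ : SublinearFunction} {β : QuasiGeodesicRay oX}
  {γ : QuasiGeodesicRay oY}

theorem IsAdjustment.inverse {E : ℝ} (hΨ : IsQuasiIsometry k K Ψ)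
    (hΨΦ : ∀ x, dist (Ψ (Φ x)) x ≤ E) (h : IsAdjustment Φ β γ) : IsAdjustment Ψ γ β := by
  obtain ⟨C, hC⟩ := h
  refine ⟨E + (k * C + K), fun t => ?_⟩
  have h1 := dist_triangle (β t) (Ψ (Φ (β t))) (Ψ (γ t))
  have h2 := hΨ.upper (Φ (β t)) (γ t)
  have h3 : k * dist (Φ (β t)) (γ t) ≤ k * C := by
    have := hΨ.one_le
    gcongr
    rw [dist_comm]
    exact hC t
  rw [dist_comm (β t) (Ψ (Φ (β t)))] at h1
  linarith [hΨΦ (β t)]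

theorem IsAdjustment.infDist_le (hΦ : IsQuasiIsometry k K Φ) (hγ : IsAdjustment Φ β γ) {Z : Set Y}
    {n : ℝ} (hn : range γ ⊆ nbhd κ oY Z n) :
    ∃ C, 0 ≤ C ∧ ∀ x, Metric.infDist (Φ x) Z ≤
      k * Metric.infDist x (range β) + C * κ (dist oX x) := by
  have hk := hΦ.one_le
  have hK := hΦ.nonneg
  obtain ⟨C, hC⟩ := hγ
  have hC0 : 0 ≤ C := dist_nonneg.trans (hC 0)
  obtain ⟨P, hP0, hP⟩ := infDist_map_le κ (oY := oY) (f := id) le_rfl le_rfl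
    (by simp) (A := range γ) (B := Z) (n := n) ⟨0, γ.start'⟩ (fun y hy => hn hy)
  obtain ⟨B, hB0, hB⟩ := exists_map_norm_le κ oY oX hk hK hΦ.upper
  refine infDist_map_le κ hk hK hΦ.upper (n := C + P * B) ⟨0, β.start'⟩ ?_
  rintro _ ⟨t, rfl⟩
  have h1 := hP (Φ (β t))
  rw [id_eq] at h1
  have h2 := Metric.infDist_le_dist_of_mem (x := Φ (β t)) (mem_range_self (f := γ) t)
  rw [dist_comm] at h2
  have h3 : P * κ (dist oY (Φ (β t))) ≤ P * (B * κ (dist oX (β t))) := by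
    gcongr
    exact hB _
  have h4 : C ≤ C * κ (dist oX (β t)) := le_mul_of_one_le_right hC0 (κ.one_le' _ dist_nonneg)
  linarith [hC t]

theorem subset_nbhd_self (κ : SublinearFunction) (o : X) (Z : Set X) : Z ⊆ nbhd κ o Z 0 :=
  fun x hx => by
    change Metric.infDist x Z ≤ 0 * κ (dist o x)
    rw [Metric.infDist_zero_of_mem hx, zero_mul]

/-- Geodesics with endpoints on the image of a contracting ray stay close to that image. -/
theorem exists_geodesics_near [ProperSpace X] (hY : IsCAT0 Y) (hΦ : IsQuasiIsometry k K Φ)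
    (hΨ : IsQuasiIsometry k (3 * k * K) Ψ) (hΦΨ : ∀ y, dist (Φ (Ψ y)) y ≤ K)
    (hΨΦ : ∀ x, dist (Ψ (Φ x)) x ≤ 2 * k * K) (hβ : IsContracting κ oX (range β))
    (hγ : IsAdjustment Φ β γ) :
    ∃ M, ∀ n : ℕ, ∃ c : ℝ → Y, c 0 = oY ∧
      (∀ s ∈ Icc 0 (dist oY (γ n)), ∀ t ∈ Icc 0 (dist oY (γ n)), dist (c s) (c t) = |s - t|) ∧
      ∀ t ∈ Icc 0 (dist oY (γ n)), Metric.infDist (c t) (range γ) ≤ M * κ t := by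
  have hk := hΦ.one_le
  have hK := hΦ.nonneg
  have hK3 : 0 ≤ 3 * k * K := by positivity
  obtain ⟨c₀, hc₀⟩ := hβ.exists_contractsWith
  have hc₀0 := hc₀.nonneg
  obtain ⟨C, hC⟩ := id hγ
  have hC0 : 0 ≤ C := dist_nonneg.trans (hC 0)
  -- A bound for the distance to `β` of both ends of the pulled-back geodesic. Since `E ≤ D`, the
  -- far-end alternative cannot occur.
  set E := dist (Ψ oY) oX + (k * (1 + C) + 5 * k * K) with hE
  have hE0 : 0 ≤ E := by positivity
  set D := 2 * (3 * k * K + k) + 4 * k ^ 2 * c₀ + E with hD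
  have hD0 : 0 ≤ D := by positivity
  have hED : E ≤ D := by
    have : 0 ≤ 2 * (3 * k * K + k) + 4 * k ^ 2 * c₀ := by positivity
    linarith
  obtain ⟨M, hM0, hM⟩ := IsDiscreteQuasiGeodesic.exists_infDist_le_or κ k (3 * k * K) c₀ D hk hK3
    hc₀0 (by linarith)
  obtain ⟨C₁, hC₁0, hC₁⟩ := hγ.infDist_le hΦ (subset_nbhd_self κ oY (range γ))
  obtain ⟨B, hB0, hB⟩ := exists_map_norm_le κ oX oY hk hK3 hΨ.upper
  refine ⟨(k * M + C₁) * B + K + 1, fun n => ?_⟩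
  obtain ⟨c, hc0, hc1, hcd⟩ := hY.geodesic oY (γ n)
  refine ⟨c, hc0, hcd, fun t ht => ?_⟩
  set d := dist oY (γ n) with hd
  have hd0 : 0 ≤ d := dist_nonneg
  have hmem : ∀ j : ℕ, j ≤ ⌊d⌋₊ → (j : ℝ) ∈ Icc 0 d := fun j hj =>
    ⟨j.cast_nonneg, (Nat.cast_le.2 hj).trans (Nat.floor_le hd0)⟩
  have hdist : ∀ i j : ℕ, i ≤ j → j ≤ ⌊d⌋₊ → dist (c i) (c j) = (j : ℝ) - i := fun i j hij hj => by
    have : (i : ℝ) ≤ j := by exact_mod_cast hij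
    rw [hcd _ (hmem i (hij.trans hj)) _ (hmem j hj), abs_sub_comm, abs_of_nonneg (by linarith)]
  have hqg : IsDiscreteQuasiGeodesic k (3 * k * K) ⌊d⌋₊ fun j => Ψ (c j) := by
    refine ⟨hk, hK3, fun i j hij hj => ?_, fun i j hij hj => ?_⟩
    · rw [← hdist i j hij hj]; exact hΨ.lower _ _
    · rw [← hdist i j hij hj]; exact hΨ.upper _ _
  have hfl : ∀ s ∈ Icc 0 d, dist (c s) (c ⌊s⌋₊) ≤ 1 := fun s hs => by
    have h1 := Nat.floor_le hs.1
    have h2 := Nat.lt_floor_add_one s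
    rw [hcd s hs _ (hmem _ (Nat.floor_le_floor hs.2)), abs_of_nonneg (by linarith)]
    linarith
  have hend : ∀ y, D ≤ D * κ (dist oX y) := fun y =>
    le_mul_of_one_le_right hD0 (κ.one_le' _ dist_nonneg)
  have hnear : Metric.infDist (Ψ (c ⌊t⌋₊)) (range β) ≤ M * κ (dist oX (Ψ (c ⌊t⌋₊))) := by
    rcases hM (isClosed_range β) (range_nonempty β) hc₀ hqg (by
      rw [Nat.cast_zero, hc0]
      have h1 := Metric.infDist_le_dist_of_mem (x := Ψ oY)
        (mem_range_self (f := β) (0 : ℝ≥0))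
      rw [β.start'] at h1
      have h2 : 0 ≤ k * (1 + C) + 5 * k * K := by positivity
      linarith [hend (Ψ oY)]) ⌊t⌋₊ (Nat.floor_le_floor ht.2) with h | h
    · exact h
    · exfalso
      have h1 := Metric.infDist_le_dist_of_mem (x := Ψ (c ⌊d⌋₊))
        (mem_range_self (f := β) (n : ℝ≥0))
      have h2 := dist_triangle (Ψ (c ⌊d⌋₊)) (Ψ (Φ (β n))) (β n)
      have h3 := hΨ.upper (c ⌊d⌋₊) (Φ (β n))
      have h4 : dist (c ⌊d⌋₊) (Φ (β n)) ≤ 1 + C := by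
        have e1 := hfl d ⟨hd0, le_rfl⟩
        rw [hc1, dist_comm] at e1
        linarith [dist_triangle (c ⌊d⌋₊) (γ n) (Φ (β n)), hC n]
      have h5 : k * dist (c ⌊d⌋₊) (Φ (β n)) ≤ k * (1 + C) := by gcongr
      have h6 := h.1
      linarith [hend (Ψ (c ⌊d⌋₊)), hΨΦ (β n), dist_nonneg (x := Ψ oY) (y := oX)]
  have hκt := κ.one_le' t ht.1
  have hnorm : dist oY (c ⌊t⌋₊) ≤ t := by
    have := hdist 0 ⌊t⌋₊ (Nat.zero_le _) (Nat.floor_le_floor ht.2)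
    rw [Nat.cast_zero, hc0, sub_zero] at this
    rw [this]
    exact Nat.floor_le ht.1
  have h1 := hC₁ (Ψ (c ⌊t⌋₊))
  have h2 : κ (dist oX (Ψ (c ⌊t⌋₊))) ≤ B * κ t := (hB _).trans (by
    gcongr
    exact κ.mono dist_nonneg hnorm)
  have h3 := Metric.infDist_le_infDist_add_dist (s := range γ) (x := c t) (y := Φ (Ψ (c ⌊t⌋₊)))
  have h4 := dist_triangle (c t) (c ⌊t⌋₊) (Φ (Ψ (c ⌊t⌋₊)))
  have h5 := hΦΨ (c ⌊t⌋₊)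
  rw [dist_comm] at h5
  have h6 := hfl t ht
  have h7 : k * Metric.infDist (Ψ (c ⌊t⌋₊)) (range β) ≤
      k * (M * κ (dist oX (Ψ (c ⌊t⌋₊)))) := by gcongr
  have h8 : (k * M + C₁) * κ (dist oX (Ψ (c ⌊t⌋₊))) ≤ (k * M + C₁) * (B * κ t) := by gcongr
  have h9 : K + 1 ≤ (K + 1) * κ t := le_mul_of_one_le_right (by linarith) hκt
  linarith

/-- Along a geodesic whose image under a quasi-isometry is far from a contracting set `W`, the
projection of that image to `W` moves by a bounded multiple of `κ`. -/
theorem dist_nearest_le_of_far (hY : IsCAT0 Y) (hΨ : IsQuasiIsometry k K Ψ) {W : Set X}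
    {π : X → X} (hπ : ∀ x, π x ∈ nearest W x) {c : ℝ}
    (hc : ContractsWith κ oX W c) {len height A : ℝ} {N : ℕ} (hN : 0 < N)
    (hlen : k * len / N + K ≤ height) {a b : Y}
    (hab : ∀ v, OnSegment a b v → height ≤ Metric.infDist (Ψ v) W) (hle : dist a b ≤ len)
    (hA : ∀ v, OnSegment a b v → κ (dist oX (Ψ v)) ≤ A) :
    dist (π (Ψ a)) (π (Ψ b)) ≤ N * (c * A) := by
  have hk := hΨ.one_le
  obtain ⟨f, hf0, hf1, hfd⟩ := hY.geodesic a b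
  set d := dist a b with hd
  have hd0 : 0 ≤ d := dist_nonneg
  have hN0 : (0 : ℝ) < N := by exact_mod_cast hN
  have hmem : ∀ j : ℕ, j ≤ N → (j : ℝ) / N * d ∈ Icc 0 d := fun j hj =>
    ⟨by positivity, mul_le_of_le_one_left hd0
      ((div_le_one hN0).2 (by exact_mod_cast hj))⟩
  have hseg : ∀ j : ℕ, j ≤ N → OnSegment a b (f (j / N * d)) := fun j hj => by
    have h := hmem j hj
    have h1 := hfd 0 ⟨le_rfl, hd0⟩ _ h
    have h2 := hfd _ h d ⟨hd0, le_rfl⟩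
    rw [hf0, zero_sub, abs_neg, abs_of_nonneg h.1] at h1
    rw [hf1, abs_sub_comm, abs_of_nonneg (by linarith [h.2])] at h2
    rw [OnSegment, h1, h2, ← hd]
    ring
  -- The image of each of the `N` pieces is no longer than its height over `W`, so contraction
  -- applies to it.
  have key : ∀ j : ℕ, j ≤ N → dist (π (Ψ a)) (π (Ψ (f (j / N * d)))) ≤ j * (c * A) := by
    intro j
    induction j with
    | zero =>
      intro _
      simp [hf0]
    | succ j ih =>
      intro hj
      have h1 := ih (by omega)
      set u := f (j / N * d) with hu
      set v := f ((j + 1 : ℕ) / N * d) with hv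
      have huv : dist u v = d / N := by
        rw [hu, hv, hfd _ (hmem j (by omega)) _ (hmem (j + 1) hj)]
        push_cast
        rw [show (j : ℝ) / N * d - (j + 1) / N * d = -(d / N) by ring, abs_neg,
          abs_of_nonneg (by positivity)]
      have h2 : dist (Ψ u) (Ψ v) ≤ Metric.infDist (Ψ u) W := by
        refine le_trans ?_ (hlen.trans (hab u (hseg j (by omega))))
        refine (hΨ.upper u v).trans ?_
        rw [huv, mul_div_assoc]
        gcongr
      have h3 := hc.dist_le (hπ (Ψ u)) (hπ (Ψ v)) h2
      have h4 : c * κ (dist oX (Ψ u)) ≤ c * A :=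
        mul_le_mul_of_nonneg_left (hA u (hseg j (by omega))) hc.nonneg
      have h5 := dist_triangle (π (Ψ a)) (π (Ψ u)) (π (Ψ v))
      push_cast
      linarith
  have h := key N le_rfl
  rwa [div_self hN0.ne', one_mul, hf1] at h

/-- A convex set at finite `κ`-distance from the image of a contracting set under a quasi-isometry
is contracting. -/
theorem isContracting_of_quasiIsometry [ProperSpace X] [ProperSpace Y] (hY : IsCAT0 Y)
    (hΨ : IsQuasiIsometry k K Ψ) {W : Set X} (hW : IsClosed W) (hWne : W.Nonempty)
    (hcon : IsContracting κ oX W) {Z : Set Y} (hZ : IsClosed Z) (hZconv : IsGeodesicallyConvex Z)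
    (hoZ : oY ∈ Z) {C₂ C₃ : ℝ} (hC₂0 : 0 ≤ C₂) (hC₃0 : 0 ≤ C₃)
    (hC₂ : ∀ y, Metric.infDist (Ψ y) W ≤ k * Metric.infDist y Z + C₂ * κ (dist oY y))
    (hC₃ : ∀ y, Metric.infDist y Z ≤ k * Metric.infDist (Ψ y) W + C₃ * κ (dist oY y)) :
    IsContracting κ oY Z := by
  obtain ⟨c, hc⟩ := hcon.exists_contractsWith
  have hc0 := hc.nonneg
  have hk := hΨ.one_le
  have hK := hΨ.nonneg
  have hk0 : 0 < k := by linarith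
  obtain ⟨B, hB0, hB⟩ := exists_map_norm_le κ oX oY hk hK hΨ.upper
  choose π hπ using nearest_nonempty hW hWne
  -- The ends of the image lie within `k * ε * l = l / (4 * k)` of `W`, up to `κ`; together they use
  -- up half of their separation `l / k`.
  set ε : ℝ := 1 / (4 * k ^ 2) with hε
  have hε0 : 0 < ε := by positivity
  have hεk : k * ε = 1 / (4 * k) := by rw [hε]; field_simp
  have hε1 : ε ≤ 1 := by
    rw [hε, div_le_one (by positivity)]
    nlinarith
  -- Independent of `l`, since the length and the height of the detour both scale with `l`.
  obtain ⟨N, hN⟩ := exists_nat_gt (40 * k ^ 2 / ε)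
  have hN0 : (0 : ℝ) < N := lt_trans (by positivity) hN
  -- For `l` above `D * κx`, the additive errors take at most half of the height `ε * l`.
  set D := 2 / ε * (k * K + C₃ * 24) with hD
  have hD0 : 0 ≤ D := by positivity
  set F := K + 2 * (C₂ * 24) + 4 * (N * (c * (B * 24))) with hF
  have hF0 : 0 ≤ F := by positivity
  suffices h : ContractsWith κ oY Z (2 * D + 4 * k * F) from h.isContracting hZ ⟨_, hoZ⟩
  refine ⟨by positivity, fun {x y p q} hp hq hxy => ?_⟩
  have hκ := κ.one_le' _ (dist_nonneg (x := oY) (y := x))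
  set κx := κ (dist oY x) with hκx
  set l := dist p q / 2 with hl
  have hpq : dist p q = 2 * l := by rw [hl]; ring
  have hDF : 0 ≤ 4 * k * F * κx := by positivity
  rcases le_or_gt l (D * κx) with hlD | hlD
  · linarith
  have hl0 : 0 < l := lt_of_le_of_lt (by positivity) hlD
  obtain ⟨a₀, a₁, a₂, a₃, a₄, h0, h4, h04, hpa, s1, s2, s3, s4⟩ :=
    exists_detour hY hZ hZconv hp hq hxy hl0 hpq hε0 hε1
  -- all points of the detour have norm at most `24 * ‖x‖`
  have hxZ : Metric.infDist x Z ≤ dist oY x := by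
    rw [dist_comm]
    exact Metric.infDist_le_dist_of_mem hoZ
  have hpn : dist oY p ≤ 2 * dist oY x := by
    have e1 := dist_triangle oY x p
    rw [hp.2] at e1
    linarith
  have hl2 : 2 * l ≤ dist oY x := by
    rw [← hpq]
    exact (hY.dist_nearest_le hZconv hp hq).trans (hxy.trans hxZ)
  have hκ24 : ∀ v, dist p v ≤ 44 * l → κ (dist oY v) ≤ 24 * κx := fun v hv => by
    refine (κ.mono dist_nonneg ?_).trans (κ.map_mul_le (by norm_num) dist_nonneg)
    linarith [dist_triangle oY p v]
  have hεl : 2 * (k * K + C₃ * 24 * κx) ≤ ε * l := by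
    have e1 : ε * (D * κx) ≤ ε * l := by gcongr
    have e2 : ε * (D * κx) = 2 * (k * K + C₃ * 24) * κx := by rw [hD]; field_simp
    have e3 : k * K ≤ k * K * κx := le_mul_of_one_le_right (by positivity) hκ
    linarith
  have seg : ∀ a b, IsHighSegment Z (10 * l) (ε * l) a b → dist p a ≤ 34 * l →
      dist (π (Ψ a)) (π (Ψ b)) ≤ N * (c * (B * (24 * κx))) := by
    intro a b hab hpa
    have hv : ∀ v, OnSegment a b v → dist p v ≤ 44 * l := fun v hv => by
      rw [OnSegment] at hv
      linarith [dist_triangle p a v, hab.1, dist_nonneg (x := v) (y := b)]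
    refine dist_nearest_le_of_far (len := 10 * l)
      (height := (ε * l - C₃ * 24 * κx) / k) hY hΨ hπ hc (by exact_mod_cast hN0) ?_
      (fun v hv' => ?_) hab.1 fun v hv' => ?_
    · have e1 : k * (10 * l) / N ≤ ε * l / (4 * k) := by
        rw [div_lt_iff₀ hε0] at hN
        rw [div_le_div_iff₀ hN0 (by positivity)]
        nlinarith
      rw [le_div_iff₀ hk0]
      have e2 : ε * l / (4 * k) * k = ε * l / 4 := by field_simp
      have e3 : k * (10 * l) / N * k ≤ ε * l / (4 * k) * k := by gcongr
      have e4 : 0 ≤ C₃ * 24 * κx := by positivity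
      nlinarith
    · rw [div_le_iff₀ hk0]
      have e1 := hC₃ v
      have e2 := hab.2 v hv'
      have e3 : C₃ * κ (dist oY v) ≤ C₃ * (24 * κx) := by
        gcongr
        exact hκ24 v (hv v hv')
      linarith
    · refine (hB v).trans ?_
      gcongr
      exact hκ24 v (hv v hv')
  have t1 : dist p a₁ ≤ 14 * l := by linarith [dist_triangle p a₀ a₁, s1.1]
  have t2 : dist p a₂ ≤ 24 * l := by linarith [dist_triangle p a₁ a₂, s2.1]
  have t3 : dist p a₃ ≤ 34 * l := by linarith [dist_triangle p a₂ a₃, s3.1]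
  have t4 : dist p a₄ ≤ 44 * l := by linarith [dist_triangle p a₃ a₄, s4.1]
  have g1 := seg a₀ a₁ s1 (by linarith)
  have g2 := seg a₁ a₂ s2 (by linarith)
  have g3 := seg a₂ a₃ s3 (by linarith)
  have g4 := seg a₃ a₄ s4 (by linarith)
  have hfar : ∀ a, Metric.infDist a Z ≤ ε * l → dist p a ≤ 44 * l →
      dist (Ψ a) (π (Ψ a)) ≤ l / (4 * k) + C₂ * 24 * κx := fun a ha hpa => by
    rw [(hπ (Ψ a)).2]
    refine (hC₂ a).trans ?_
    have e1 : k * Metric.infDist a Z ≤ k * (ε * l) := by gcongr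
    have e2 : k * (ε * l) = l / (4 * k) := by rw [← mul_assoc, hεk]; ring
    have e3 : C₂ * κ (dist oY a) ≤ C₂ * (24 * κx) := by
      gcongr
      exact hκ24 a hpa
    linarith
  have f0 := hfar a₀ h0 (by linarith)
  have f4 := hfar a₄ h4 t4
  rw [dist_comm] at f4
  have u1 := dist_triangle4 (Ψ a₀) (π (Ψ a₀)) (π (Ψ a₄)) (Ψ a₄)
  have u2 := dist_triangle4 (π (Ψ a₀)) (π (Ψ a₁)) (π (Ψ a₂)) (π (Ψ a₄))
  have u3 := dist_triangle (π (Ψ a₂)) (π (Ψ a₃)) (π (Ψ a₄))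
  have u4 := hΨ.lower a₀ a₄
  have u5 : 1 / k * l ≤ 1 / k * dist a₀ a₄ := by gcongr
  have u6 : 1 / k * l = 2 * (l / (4 * k)) + l / (2 * k) := by field_simp; ring
  have u7 : l / (2 * k) ≤ F * κx := by
    have : K ≤ K * κx := le_mul_of_one_le_right hK hκ
    rw [hF]
    linarith
  rw [div_le_iff₀ (by positivity)] at u7
  have : 0 ≤ 2 * D * κx := by positivity
  linarith

/-- The image of a contracting ray under a quasi-isometry to a `CAT(0)` space fellow travels a
contracting geodesic ray. -/
theorem exists_contracting_geodesic [ProperSpace X] [ProperSpace Y] (hY : IsCAT0 Y)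
    (hΦ : IsQuasiIsometry k K Φ) (hβ : IsContracting κ oX (range β)) (hγ : IsAdjustment Φ β γ) :
    ∃ b : QuasiGeodesicRay oY, Isometry b ∧ FellowTravel κ b γ ∧ IsContracting κ oY (range b) := by
  obtain ⟨Ψ, hΨ, hΦΨ, hΨΦ⟩ := hΦ.exists_inverse
  have hk := hΦ.one_le
  have hK := hΦ.nonneg
  have hK3 : 0 ≤ 3 * k * K := by positivity
  obtain ⟨M, hM⟩ := exists_geodesics_near hY hΦ hΨ hΦΨ hΨΦ hβ hγ
  obtain ⟨b, hb, hbM⟩ := exists_geodesic_ray γ hM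
  have hft := fellowTravel_of_subset hbM
  obtain ⟨n, hn⟩ := hft.2
  have ho : oY ∈ range b := ⟨0, b.start'⟩
  obtain ⟨P₁, hP₁0, hP₁⟩ := (hγ.inverse hΨ hΨΦ).infDist_le hΨ (subset_nbhd_self κ oX (range β))
  obtain ⟨C₂, hC₂0, hC₂⟩ := infDist_map_le κ (oY := oY) hk hK3 hΨ.upper (A := range b)
    (B := range β) (n := k * M + P₁) ho (by
      intro y hy
      have h1 : k * Metric.infDist y (range γ) ≤ k * (M * κ (dist oY y)) := by
        gcongr
        exact hbM hy
      linarith [hP₁ y])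
  obtain ⟨P₃, hP₃0, hP₃⟩ := hγ.infDist_le hΦ hn
  obtain ⟨B₂, hB₂0, hB₂⟩ := exists_map_norm_le κ oX oY hk hK3 hΨ.upper
  refine ⟨b, hb, hft, isContracting_of_quasiIsometry hY hΨ (isClosed_range β) (range_nonempty β) hβ
    (isClosed_range b) (hY.isGeodesicallyConvex_range hb) ho hC₂0
    (by positivity : 0 ≤ P₃ * B₂ + K) hC₂ fun y => ?_⟩
  have h1 := Metric.infDist_le_infDist_add_dist (s := range b) (x := y) (y := Φ (Ψ y))
  have h2 := hΦΨ y
  rw [dist_comm] at h2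
  have h3 := hP₃ (Ψ y)
  have h4 : P₃ * κ (dist oX (Ψ y)) ≤ P₃ * (B₂ * κ (dist oY y)) := by
    gcongr
    exact hB₂ y
  have h5 : K ≤ K * κ (dist oY y) := le_mul_of_one_le_right hK (κ.one_le' _ dist_nonneg)
  linarith

end Transfer

/-! ### The boundary map and its continuity. -/

section Boundary

variable {X Y : Type*} [MetricSpace X] [MetricSpace Y] {oX : X} {oY : Y}
  {k K : ℝ} {Φ : X → Y} {Ψ : Y → X} {κ : SublinearFunction} {β β' : QuasiGeodesicRay oX}
  {γ γ' : QuasiGeodesicRay oY}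

/-- The bound `C` is uniform over all rays with given constants, as continuity requires. -/
theorem exists_adjustment (hY : IsCAT0 Y) (hΦ : IsQuasiIsometry k K Φ) (oX : X) (oY : Y) (q Q : ℝ) :
    ∃ C, ∀ β : QuasiGeodesicRay oX, IsQIRay q Q β →
      ∃ γ : QuasiGeodesicRay oY, ∀ t, dist (γ t) (Φ (β t)) ≤ C :=
  ⟨_, fun β hβ => exists_continuous_ray hY.geodesic (hβ.comp hΦ) (E := dist oY (Φ oX))
    (by rw [β.start'])⟩

theorem exists_isAdjustment (hY : IsCAT0 Y) (hΦ : IsQuasiIsometry k K Φ)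
    (β : QuasiGeodesicRay oX) : ∃ γ : QuasiGeodesicRay oY, IsAdjustment Φ β γ := by
  obtain ⟨q, Q, hβ⟩ := β.quasi'
  obtain ⟨C, hC⟩ := exists_adjustment hY hΦ oX oY q Q
  obtain ⟨γ, hγ⟩ := hC β hβ
  exact ⟨γ, C, hγ⟩

/-- One inclusion is enough by `fellowTravel_of_subset`; the quasi-inverse serves to bound `κ` at `β
t` by `κ` at `γ t`. -/
theorem fellowTravel_of_isAdjustment (hΦ : IsQuasiIsometry k K Φ) (h : FellowTravel κ β β')
    (hγ : IsAdjustment Φ β γ) (hγ' : IsAdjustment Φ β' γ') : FellowTravel κ γ γ' := by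
  obtain ⟨Ψ, hΨ, -, hΨΦ⟩ := hΦ.exists_inverse
  have hk := hΦ.one_le
  obtain ⟨C₁, hC₁0, hC₁⟩ := hγ'.infDist_le hΦ (subset_nbhd_self κ oY (range γ'))
  obtain ⟨C', hC'⟩ := hγ.inverse hΨ hΨΦ
  obtain ⟨C, hC⟩ := hγ
  have hC0 : 0 ≤ C := dist_nonneg.trans (hC 0)
  have hC'0 : 0 ≤ C' := dist_nonneg.trans (hC' 0)
  obtain ⟨B, hB0, hB⟩ := exists_map_norm_le κ oX oY hΨ.one_le hΨ.nonneg hΨ.upper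
  obtain ⟨n, hn⟩ := h.1
  have hκ1 := κ.one_le' 1 zero_le_one
  refine fellowTravel_of_subset (n := C + (k * |n| + C₁) * ((1 + C') * κ 1 * B)) ?_
  rintro _ ⟨t, rfl⟩
  have h1 : Metric.infDist (β t) (range β') ≤ |n| * κ (dist oX (β t)) :=
    (show Metric.infDist (β t) (range β') ≤ n * κ (dist oX (β t)) from hn ⟨t, rfl⟩).trans
      (mul_le_mul_of_nonneg_right (le_abs_self n) (κ.pos dist_nonneg).le)
  have h2 : κ (dist oX (β t)) ≤ (1 + C') * κ 1 * (B * κ (dist oY (γ t))) := by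
    refine (κ.mono dist_nonneg ?_).trans ((κ.map_affine_le le_rfl hC'0 dist_nonneg).trans
      (mul_le_mul_of_nonneg_left (hB (γ t)) (by positivity)))
    have := dist_triangle oX (Ψ (γ t)) (β t)
    rw [dist_comm (Ψ (γ t)) (β t)] at this
    linarith [hC' t]
  have h3 := Metric.infDist_le_infDist_add_dist (s := range γ') (x := γ t) (y := Φ (β t))
  have h4 := hC₁ (β t)
  have h5 : k * Metric.infDist (β t) (range β') ≤ k * (|n| * κ (dist oX (β t))) := by gcongr
  have h6 : (k * |n| + C₁) * κ (dist oX (β t)) ≤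
      (k * |n| + C₁) * ((1 + C') * κ 1 * (B * κ (dist oY (γ t)))) := by gcongr
  have h7 : C ≤ C * κ (dist oY (γ t)) := le_mul_of_one_le_right hC0 (κ.one_le' _ dist_nonneg)
  change Metric.infDist (γ t) (range γ') ≤ _ * κ (dist oY (γ t))
  linarith [hC t]

theorem Belongs.fellowTravel {b : MorseBoundary κ oX} (h : Belongs β b) (h' : Belongs β' b) :
    FellowTravel κ β β' :=
  Quotient.exact (s := fellowTravelSetoid κ oX) (Eq.trans h (Eq.symm h'))

/-- Transfer along the identity map straightens a contracting quasi-geodesic ray to a contracting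
geodesic ray. -/
theorem nonempty_gaugedGeodesic [ProperSpace X] (hX : IsCAT0 X) (b : MorseBoundary κ oX) :
    Nonempty (GaugedGeodesic b) := by
  obtain ⟨β, hβ, hb⟩ := b.2
  have hid : IsQuasiIsometry 1 0 (id : X → X) :=
    ⟨le_rfl, le_rfl, by simp, by simp, fun x => ⟨x, by simp⟩⟩
  obtain ⟨g, hg, hft, hcon⟩ := exists_contracting_geodesic (γ := β) hX hid hβ ⟨0, by simp⟩
  obtain ⟨m, hm⟩ := exists_strongMorseGauge (isClosed_range g) ⟨0, g.start'⟩ hcon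
  exact ⟨⟨g, hg, (Quotient.sound (s := fellowTravelSetoid κ oX) hft).trans hb, m, hm⟩⟩

/-- A quasi-isometry induces a map of Morse boundaries. -/
theorem exists_boundaryMap [ProperSpace X] [ProperSpace Y] (hY : IsCAT0 Y)
    (hΦ : IsQuasiIsometry k K Φ) (κ : SublinearFunction) (oX : X) (oY : Y) :
    ∃ F : MorseBoundary κ oX → MorseBoundary κ oY,
      ∀ (b : MorseBoundary κ oX) (β : QuasiGeodesicRay oX) (γ : QuasiGeodesicRay oY),
        Belongs β b → IsAdjustment Φ β γ → Belongs γ (F b) := by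
  have h : ∀ b : MorseBoundary κ oX, ∃ b' : MorseBoundary κ oY,
      ∀ (β : QuasiGeodesicRay oX) (γ : QuasiGeodesicRay oY),
        Belongs β b → IsAdjustment Φ β γ → Belongs γ b' := by
    intro b
    obtain ⟨β₀, hβ₀, hb⟩ := b.2
    obtain ⟨γ₀, hγ₀⟩ := exists_isAdjustment (oY := oY) hY hΦ β₀
    obtain ⟨g, -, hft, hcon⟩ := exists_contracting_geodesic hY hΦ hβ₀ hγ₀
    refine ⟨⟨rayClass κ γ₀, g, hcon, Quotient.sound (s := fellowTravelSetoid κ oY) hft⟩,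
      fun β γ hβ hγ => ?_⟩
    exact Quotient.sound (s := fellowTravelSetoid κ oY)
      (fellowTravel_of_isAdjustment hΦ (hβ.fellowTravel hb) hγ hγ₀)
  choose F hF using h
  exact ⟨F, hF⟩

/-- The constants are fixed in the order `r'`, `n`, `R`, `r`. Here `n` bounds the distance at radius
`R` after the round trip through `X` and must not depend on `R`, which the strong gauge produces
from it. -/
theorem continuous_boundaryMap (hX : IsCAT0 X) (hY : IsCAT0 Y) (hΦ : IsQuasiIsometry k K Φ)
    {K' E : ℝ} (hΨ : IsQuasiIsometry k K' Ψ) (hΦΨ : ∀ y, dist (Φ (Ψ y)) y ≤ E)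
    {F : MorseBoundary κ oX → MorseBoundary κ oY} {G : MorseBoundary κ oY → MorseBoundary κ oX}
    (hF : ∀ (b : MorseBoundary κ oX) (β : QuasiGeodesicRay oX) (γ : QuasiGeodesicRay oY),
      Belongs β b → IsAdjustment Φ β γ → Belongs γ (F b))
    (hG : ∀ (b : MorseBoundary κ oY) (β : QuasiGeodesicRay oY) (γ : QuasiGeodesicRay oX),
      Belongs β b → IsAdjustment Ψ β γ → Belongs γ (G b))
    (hGF : ∀ b, G (F b) = b) (gX : ∀ b : MorseBoundary κ oX, GaugedGeodesic b)
    (gY : ∀ b : MorseBoundary κ oY, GaugedGeodesic b) :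
    @Continuous _ _ (visualTopology gX) (visualTopology gY) F := by
  have hk := hΦ.one_le
  have hK := hΦ.nonneg
  have hK' := hΨ.nonneg
  have hκ1 := κ.one_le' 1 zero_le_one
  refine @Continuous.mk _ _ (visualTopology gX) (visualTopology gY) F fun V hV b hb => ?_
  obtain ⟨r', hr', hV'⟩ := hV (F b) hb
  obtain ⟨γb, hγb⟩ := exists_isAdjustment (oY := oY) hY hΦ (gX b).ray
  obtain ⟨n₁, hn₁⟩ := ((hF b _ γb (gX b).belongs hγb).fellowTravel (gY (F b)).belongs).1
  obtain ⟨C₁, hC₁0, hC₁⟩ := hγb.infDist_le hΦ hn₁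
  obtain ⟨B, hB0, hB⟩ := exists_map_norm_le κ oX oY hk hK' hΨ.upper
  -- Rays whose gauge is small compared to `r'` have constants at most `r'`, so one pair of
  -- constants serves for all of them.
  set q₁ := max r' 1 with hq₁
  have hq₁1 : 1 ≤ q₁ := le_max_right _ _
  obtain ⟨C, hC⟩ := exists_adjustment hX hΨ oY oX q₁ q₁
  set μ := (gX b).gauge (k * q₁) (k * q₁ + K' + 2 * C) with hμ
  obtain ⟨T, hT0, hT⟩ := exists_isSmall κ μ
  -- Nonnegativity of `C` is known only once a ray is at hand, hence `|C|`.
  set n := E + (k * |C| + K) + |k * μ + C₁| * ((1 + |C|) * κ 1 * B) + 1 with hn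
  have hE0 : 0 ≤ E := dist_nonneg.trans (hΦΨ oY)
  have hn0 : 0 < n := by positivity
  obtain ⟨R, hR0, hR⟩ := (gY (F b)).isGauge.strong r' n κ hr' hn0
  -- Large enough that `μ` is small compared to `r` and that `α` has not yet left the ball of radius
  -- `r` when `α'` first reaches norm `R`.
  set r := T + |k * q₁ * (q₁ * (R + q₁)) + (k * q₁ + K' + 2 * C)| + 1 with hr
  have hr0 : 0 < r := by positivity
  refine ⟨r, hr0, fun a ha => hV' fun q Q α' hα' hq hsm => hR q Q α' hq hsm ?_⟩
  have hmr : (gY (F b)).gauge q Q ≤ r' :=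
    hsm.trans (div_le_self hr'.le (by linarith [κ.one_le' r' hr'.le]))
  have hmax := ((gY (F b)).isGauge.max_le q Q hq.one_le hq.nonneg).trans hmr
  have hα'q : IsQIRay q₁ q₁ α' := hq.mono
    (((le_max_left _ _).trans hmax).trans (le_max_left _ _))
    (((le_max_right _ _).trans hmax).trans (le_max_left _ _))
  obtain ⟨α, hα⟩ := hC α' hα'q
  have hC0 : 0 ≤ C := dist_nonneg.trans (hα 0)
  rw [abs_of_nonneg hC0] at hn
  have hαq : IsQIRay (k * q₁) (k * q₁ + K' + 2 * C) α := (hα'q.comp hΨ).of_dist_le hα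
  have hαa : Belongs α a := by
    have := hG (F a) α' α hα' ⟨C, hα⟩
    rwa [hGF] at this
  set t := firstTime α' R with ht
  have htR : dist oY (α' t) = R := dist_firstTime α' hR0.le
  have htr : t ≤ firstTime α r := by
    by_contra! hcon
    have h1 := hαq.norm_le (firstTime α r)
    rw [dist_firstTime α hr0.le] at h1
    have h2 := hα'q.le_norm t
    rw [htR] at h2
    have h3 : ((firstTime α r : ℝ≥0) : ℝ) ≤ t := hcon.le
    have h4 : k * q₁ * (firstTime α r : ℝ≥0) ≤ k * q₁ * (q₁ * (R + q₁)) := by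
      gcongr
      exact h3.trans h2
    have h5 := le_abs_self (k * q₁ * (q₁ * (R + q₁)) + (k * q₁ + K' + 2 * C))
    linarith
  have h1 : Metric.infDist (α t) (range (gX b).ray) ≤ μ * κ (dist oX (α t)) :=
    ha _ _ α hαa hαq (hT r (by
      rw [hr]
      linarith [abs_nonneg (k * q₁ * (q₁ * (R + q₁)) + (k * q₁ + K' + 2 * C))])) ⟨t, htr, rfl⟩
  have h2 := hC₁ (α t)
  have h3 := Metric.infDist_le_infDist_add_dist (s := range (gY (F b)).ray) (x := α' t)
    (y := Φ (α t))
  have h4 : dist (α' t) (Φ (α t)) ≤ E + (k * C + K) := by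
    have e1 := dist_triangle (α' t) (Φ (Ψ (α' t))) (Φ (α t))
    have e2 := hΦΨ (α' t)
    have e3 := hΦ.upper (Ψ (α' t)) (α t)
    have e4 : k * dist (Ψ (α' t)) (α t) ≤ k * C := by
      gcongr
      rw [dist_comm]
      exact hα t
    rw [dist_comm (α' t) (Φ (Ψ (α' t)))] at e1
    linarith
  have h5 : κ (dist oX (α t)) ≤ (1 + C) * κ 1 * (B * κ R) := by
    have e := hB (α' t)
    rw [htR] at e
    refine (κ.mono dist_nonneg ?_).trans ((κ.map_affine_le le_rfl hC0 dist_nonneg).trans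
      (mul_le_mul_of_nonneg_left e (by positivity)))
    have := dist_triangle oX (Ψ (α' t)) (α t)
    rw [dist_comm (Ψ (α' t)) (α t)] at this
    linarith [hα t]
  have h6 : (k * μ + C₁) * κ (dist oX (α t)) ≤
      |k * μ + C₁| * ((1 + C) * κ 1 * (B * κ R)) :=
    (mul_le_mul_of_nonneg_right (le_abs_self _) (κ.pos dist_nonneg).le).trans
      (mul_le_mul_of_nonneg_left h5 (abs_nonneg _))
  have h7 : k * Metric.infDist (α t) (range (gX b).ray) ≤ k * (μ * κ (dist oX (α t))) := by gcongr
  have hκR := κ.one_le' R hR0.le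
  have h8 : E + (k * C + K) ≤ (E + (k * C + K)) * κ R :=
    le_mul_of_one_le_right (by positivity) hκR
  rw [hn]
  linarith

end Boundary

end SublinearMorse

theorem theorem5p1 {X Y : Type*} [MetricSpace X] [ProperSpace X] [MetricSpace Y] [ProperSpace Y]
    (hX : IsCAT0 X) (hY : IsCAT0 Y) (oX : X) (oY : Y)
    (k K : ℝ) (Φ : X → Y) (hΦ : IsQuasiIsometry k K Φ) (κ : SublinearFunction) :
    (∀ b : MorseBoundary κ oX, Nonempty (GaugedGeodesic b)) ∧
    (∀ b : MorseBoundary κ oY, Nonempty (GaugedGeodesic b)) ∧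
    (∀ β : QuasiGeodesicRay oX, ∃ γ : QuasiGeodesicRay oY, IsAdjustment Φ β γ) ∧
    ∃ F : MorseBoundary κ oX → MorseBoundary κ oY,
      (∀ (b : MorseBoundary κ oX) (β : QuasiGeodesicRay oX) (γ : QuasiGeodesicRay oY),
        Belongs β b → IsAdjustment Φ β γ → Belongs γ (F b)) ∧
      ∀ (gX : ∀ b : MorseBoundary κ oX, GaugedGeodesic b)
        (gY : ∀ b : MorseBoundary κ oY, GaugedGeodesic b),
        @IsHomeomorph _ _ (visualTopology gX) (visualTopology gY) F := by
  refine ⟨nonempty_gaugedGeodesic hX, nonempty_gaugedGeodesic hY, exists_isAdjustment hY hΦ, ?_⟩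
  obtain ⟨Ψ, hΨ, hΦΨ, hΨΦ⟩ := hΦ.exists_inverse
  obtain ⟨F, hF⟩ := exists_boundaryMap hY hΦ κ oX oY
  obtain ⟨G, hG⟩ := exists_boundaryMap hX hΨ κ oY oX
  -- If `γ` adjusts `Φ ∘ β`, then `β` itself adjusts `Ψ ∘ γ`.
  have hGF : ∀ b, G (F b) = b := fun b => by
    obtain ⟨β, -, hβ⟩ := b.2
    obtain ⟨γ, hγ⟩ := exists_isAdjustment (oY := oY) hY hΦ β
    exact Subtype.ext ((hG _ γ β (hF b β γ hβ hγ) (hγ.inverse hΨ hΨΦ)).symm.trans hβ)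
  have hFG : ∀ b, F (G b) = b := fun b => by
    obtain ⟨γ, -, hγ⟩ := b.2
    obtain ⟨β, hβ⟩ := exists_isAdjustment (oY := oX) hX hΨ γ
    exact Subtype.ext ((hF _ β γ (hG b γ β hγ hβ) (hβ.inverse hΦ hΦΨ)).symm.trans hγ)
  refine ⟨F, hF, fun gX gY => ?_⟩
  let _ := visualTopology gX
  let _ := visualTopology gY
  exact (Homeomorph.mk ⟨F, G, hGF, hFG⟩
    (continuous_boundaryMap hX hY hΦ hΨ hΦΨ hF hG hGF gX gY)
    (continuous_boundaryMap hY hX hΨ hΦ hΨΦ hG hF hFG gY gX)).isHomeomorph
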